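/- \textbf{Model.} Let $a>b\ge 0$ and $s_1,s_2\in[0,1]$ be fixed. For $n=2m$, let $\mathcal C:[n]\to\{1,2\}$ be uniformly random among the labelings of the vertices for which both communities have exactly $m$ members. Given $\mathcal C$, let $G\sim SBM(n,p,q)$ with $p=\frac{a\log n}{n}$, $q=\frac{b\log n}{n}$ (capped at $1$, which matters only for small $n$): distinct vertices $u,v$ are adjacent, independently over pairs, with probability $p$ if $\mathcal C(u)=\mathcal C(v)$ and with probability $q$ otherwise. Given $G$, the graphs $G_1$ and $G_2$ are obtained independently of each other by keeping each edge of $G$ independently with probability $s_1$ and $s_2$, respectively. Let $\pi$ be a uniformly random permutation of $[n]$, independent of everything else; the anonymized graph $\pi(G_2)$ has the edges $\{\pi(u),\pi(v)\}$ for $\{u,v\}\in E(G_2)$, and its vertex $\pi(v)$ has community label $\mathcal C(v)$. For $t\in[0,1]$, the $t$-subsampled $\pi(G_2)$, denoted $H_t$, is obtained by keeping each edge of $\pi(G_2)$ independently with probability $t$. \emph{Exact community recovery is possible} in a random graph with community labels if there is a (possibly randomized) algorithm, that is, an estimator for each $n$, which given only the graph outputs the community labels, up to renaming the two communities, with probability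 $1-o(1)$ as $n\to\infty$. The graph $H_t$ \emph{cannot be exactly deanonymized given $G_1$} if every (possibly randomized) attack that observes $G_1$, $H_t$ and the true community labels of the vertices of both graphs outputs a map $\hat\pi:[n]\to[n]$ with $\mathbb P[\hat\pi=\pi]\to 0$ as $n\to\infty$. \textbf{Corollary.} Suppose that exact community recovery is possible in $G_2$ and that $$\left(\frac{a-b}{a+b}\right)^2+(1-s_1)^2>1.$$ Then there is a $t\in[0,1]$, not depending on $n$, such that exact community recovery is possible in $H_t$, but $H_t$ cannot be exactly deanonymized given $G_1$. -/

import Mathlib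

namespace CommunityPrivacy

/-- The law of a random subset of `α` which contains each `i` independently with probability
`f i`. -/
noncomputable def randomSubset {α : Type*} [Fintype α] [DecidableEq α] (f : α → unitInterval) :
    PMF (Finset α) :=
  PMF.ofFintype
    (fun T => (∏ i ∈ T, ENNReal.ofReal (f i)) * ∏ i ∈ Tᶜ, ENNReal.ofReal (1 - (f i : ℝ))) (by
      rw [← Fintype.prod_add]
      refine Finset.prod_eq_one fun i _ => ?_
      rw [← ENNReal.ofReal_add (f i).2.1 (sub_nonneg.2 (f i).2.2)]
      simp)

/-- `P[E]` for a random element with law `μ`. -/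
noncomputable def prob {α : Type*} (μ : PMF α) (E : Set α) : ENNReal := μ.toOuterMeasure E

/-- The community labelings of `C * m` vertices for which each of the `C` communities has exactly
`m` members. -/
abbrev BalancedLabeling (C m : ℕ) : Type :=
  {σ : Fin (C * m) → Fin C // ∀ k, Fintype.card {v // σ v = k} = m}

instance (C m : ℕ) : Nonempty (BalancedLabeling C m) := by
  refine ⟨⟨fun v => (finProdFinEquiv.symm v).1, fun k => ?_⟩⟩
  have e : {v : Fin (C * m) // (finProdFinEquiv.symm v).1 = k} ≃ Fin m :=
    { toFun := fun v => (finProdFinEquiv.symm v.1).2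
      invFun := fun j => ⟨finProdFinEquiv (k, j), by simp⟩
      left_inv := by
        rintro ⟨v, hv⟩
        apply Subtype.ext
        apply finProdFinEquiv.symm.injective
        rw [Equiv.symm_apply_apply]
        exact Prod.ext hv.symm rfl
      right_inv := fun j => by simp }
  simpa using Fintype.card_congr e

/-- The stochastic block model with communities `σ`: distinct vertices `u`, `v` are adjacent with
probability `p` if `σ u = σ v` and with probability `q` otherwise, independently over the
unordered pairs (`SimpleGraph.fromEdgeSet` ignores the coins of the diagonal pairs). -/
noncomputable def sbm {n C : ℕ} (σ : Fin n → Fin C) (p q : unitInterval) :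
    PMF (SimpleGraph (Fin n)) :=
  (randomSubset fun e : Sym2 (Fin n) => if (e.map σ).IsDiag then p else q).map
    fun T => SimpleGraph.fromEdgeSet (T : Set (Sym2 (Fin n)))

/-- Edge subsampling: each edge of `G` is kept independently with probability `s`. -/
noncomputable def subsample {n : ℕ} (s : unitInterval) (G : SimpleGraph (Fin n)) :
    PMF (SimpleGraph (Fin n)) :=
  (randomSubset fun _ : Sym2 (Fin n) => s).map
    fun T => SimpleGraph.fromEdgeSet (G.edgeSet ∩ (T : Set (Sym2 (Fin n))))

/-- The edge probability `c log n / n`, capped at `1` (the cap is inactive for large `n`). -/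
noncomputable def edgeProb (c : ℝ) (n : ℕ) : unitInterval :=
  Set.projIcc 0 1 zero_le_one (c * Real.log n / n)

/-- Two labelings are equal up to a renaming of the communities. -/
def SameCommunities {n C : ℕ} (σ τ : Fin n → Fin C) : Prop :=
  ∃ ρ : Equiv.Perm (Fin C), ∀ v, τ v = ρ (σ v)

/-- Exact community recovery is possible in the random graph whose joint law with its community
labels is `law m` (for `C * m` vertices): some (possibly randomized) algorithm which sees only
the graph outputs the communities with probability `1 - o(1)`. -/
def ExactRecoveryPossible (C : ℕ)
    (law : ∀ m : ℕ, PMF ((Fin (C * m) → Fin C) × SimpleGraph (Fin (C * m)))) : Prop :=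
  ∃ A : ∀ m : ℕ, SimpleGraph (Fin (C * m)) → PMF (Fin (C * m) → Fin C),
    Filter.Tendsto
      (fun m => prob ((law m).bind fun x => (A m x.2).map fun τ => (x.1, τ))
        {y | SameCommunities y.1 y.2})
      Filter.atTop (nhds 1)

/-- The underlying randomness of the model on `n` vertices with `C` communities. -/
structure Sample (n C : ℕ) where
  /-- the community labels -/
  label : Fin n → Fin C
  /-- the auxiliary graph `G₁` -/
  aux : SimpleGraph (Fin n)
  /-- the sensitive graph `G₂` -/
  sens : SimpleGraph (Fin n)
  /-- the anonymizing permutation `π` -/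
  anon : Equiv.Perm (Fin n)
  /-- the released graph, a subsampled version of `π(G₂)` -/
  released : SimpleGraph (Fin n)

/-- The labels carried by the vertices of `π(G₂)`: vertex `π v` has the label of `v`. -/
def Sample.releasedLabel {n C : ℕ} (x : Sample n C) : Fin n → Fin C :=
  fun v => x.label (x.anon.symm v)

/-- The joint law: uniform balanced labels; `G` from the stochastic block model with
`p = a log n / n`, `q = b log n / n`, where `n = C * m`; given `G`, independent subsamples `G₁` and
`G₂` with probabilities `s₁` and `s₂`; an independent uniform permutation `π`; and the released
graph, the `t`-subsample of `π(G₂)`. -/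
noncomputable def model (C : ℕ) (a b : ℝ) (s₁ s₂ t : unitInterval) (m : ℕ) :
    PMF (Sample (C * m) C) :=
  (PMF.uniformOfFintype (BalancedLabeling C m)).bind fun σ =>
  (sbm σ.1 (edgeProb a (C * m)) (edgeProb b (C * m))).bind fun G =>
  (subsample s₁ G).bind fun G₁ =>
  (subsample s₂ G).bind fun G₂ =>
  (PMF.uniformOfFintype (Equiv.Perm (Fin (C * m)))).bind fun π =>
  (subsample t (G₂.map π)).map fun H =>
    { label := σ.1, aux := G₁, sens := G₂, anon := π, released := H }

/-- The joint law of the community labels and `G₂`. It does not involve `G₁` or `π`. -/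
noncomputable def sensLaw (C : ℕ) (a b : ℝ) (s₂ : unitInterval) (m : ℕ) :
    PMF ((Fin (C * m) → Fin C) × SimpleGraph (Fin (C * m))) :=
  (PMF.uniformOfFintype (BalancedLabeling C m)).bind fun σ =>
  (sbm σ.1 (edgeProb a (C * m)) (edgeProb b (C * m))).bind fun G =>
  (subsample s₂ G).map fun G₂ => (σ.1, G₂)

/-- `sensLaw` is the marginal of `model`. -/
theorem map_model_sens (C : ℕ) (a b : ℝ) (s₁ s₂ t : unitInterval) (m : ℕ) :
    (model C a b s₁ s₂ t m).map (fun x => (x.label, x.sens)) = sensLaw C a b s₂ m := by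
  have key : ∀ {α β : Type} (p : PMF α) (c : β), p.map (fun _ => c) = PMF.pure c :=
    fun p c => PMF.map_const p c
  simp only [model, sensLaw, PMF.map_bind, PMF.map_comp, Function.comp_def, key, PMF.bind_const]
  rfl

/-- The released graph together with the community labels of its vertices. -/
noncomputable def releasedLaw (C : ℕ) (a b : ℝ) (s₁ s₂ t : unitInterval) (m : ℕ) :
    PMF ((Fin (C * m) → Fin C) × SimpleGraph (Fin (C * m))) :=
  (model C a b s₁ s₂ t m).map fun x => (x.releasedLabel, x.released)

/-- What the adversary sees: `G₁`, the released graph, and the true labels of the vertices of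
both graphs. -/
structure Observation (n C : ℕ) where
  /-- the auxiliary graph -/
  aux : SimpleGraph (Fin n)
  /-- the released graph -/
  released : SimpleGraph (Fin n)
  /-- the labels of the vertices of the auxiliary graph -/
  auxLabel : Fin n → Fin C
  /-- the labels of the vertices of the released graph -/
  releasedLabel : Fin n → Fin C

/-- The adversary's view of a sample. -/
def Sample.view {n C : ℕ} (x : Sample n C) : Observation n C where
  aux := x.aux
  released := x.released
  auxLabel := x.label
  releasedLabel := x.releasedLabel

/-- Exact deanonymization of the released graph given `G₁` is impossible: every (possibly
randomized) attack outputs exactly the true permutation only with probability `o(1)`. -/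
def DeanonymizationImpossible (C : ℕ) (law : ∀ m : ℕ, PMF (Sample (C * m) C)) : Prop :=
  ∀ A : ∀ m : ℕ, Observation (C * m) C → PMF (Fin (C * m) → Fin (C * m)),
    Filter.Tendsto
      (fun m => prob ((law m).bind fun x => (A m x.view).map fun φ => (x, φ))
        {y | y.2 = y.1.anon})
      Filter.atTop (nhds 0)

end CommunityPrivacy

/-!
Write `r = s₂ * t`. As the labels are uniform, the anonymization is invisible in the joint law of
the released graph and its labels, which is that of a block model subsampled with probability `r`
(`releasedLaw_eq_sensLaw`). Two thresholds for `r` matter.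

*Recovery* succeeds if `r * (√a - √b) ^ 2 > 2` (`exactRecoveryPossible_sensLaw`). The estimator is
a minimum bisection. A balanced labeling which disagrees with the truth on `d` of the `n` vertices
misplaces `d (n - d) / 2` pairs in each direction (`card_sepPairs`). The Chernoff bound
`prob_cutSize_le`, with the tilt of `exists_tilt`, shows that it cuts no more edges than the truth
with probability at most `n ^ (-γ d (n - d) / n)` for some `γ > 1`, and these bounds sum to `o(1)`
over all labelings but the truth and its flip (`tendsto_sum_choose_mul_exp`).

*Deanonymization* fails if `s₁ * r * (a + b) < 2` (`deanonymizationImpossible_model`). Pull the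
released graph back to the vertices of the auxiliary graph. If `u` and `v` have the same label and
are isolated in the intersection of the two graphs, then exchanging them in the pulled-back graph
does not decrease the likelihood (`pairLaw_le_swap`), while to the adversary it is the same as
another anonymization (`viewOf_map_perm`). Hence, if there are `M` such vertices, the true
anonymization is one of `M` equally plausible candidates, and no attack finds it with probability
above `1 / M` (`sum_mul_success_le`). The intersection is itself a sparser block model
(`pairLaw_map_inf`), which has many isolated vertices by the second moment method
(`prob_isolatedZero_lt_le`, `tendsto_expected_isolated`).

The hypothesis on `a`, `b`, `s₁` says `s₁ * (a + b) < (√a - √b) ^ 2`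
(`mul_add_lt_sq_sqrt_sub_sqrt`). If `s₁ * s₂ * (a + b) < 2`, then `t = 1` works, and recovery is the
hypothesis on `G₂`. Otherwise `s₂ * (√a - √b) ^ 2 > 2` holds strictly, and `r` can be decreased to
lie strictly between the two thresholds. The converse, that recovery fails below its threshold,
plays no role.
-/

namespace CommunityPrivacy

open Finset Filter Topology

/-! ### Random subsets -/

section RandomSubset

variable {α : Type*} [Fintype α] [DecidableEq α]

theorem randomSubset_apply (f : α → unitInterval) (T : Finset α) :
    randomSubset f T =
      ∏ i, if i ∈ T then ENNReal.ofReal (f i) else ENNReal.ofReal (1 - (f i : ℝ)) := by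
  classical
  rw [Finset.prod_ite]
  simp [randomSubset, PMF.ofFintype_apply, Finset.filter_not, Finset.compl_eq_univ_sdiff]

theorem toReal_randomSubset_apply (f : α → unitInterval) (T : Finset α) :
    (randomSubset f T).toReal = ∏ i, if i ∈ T then (f i : ℝ) else 1 - (f i : ℝ) := by
  rw [randomSubset_apply, ENNReal.toReal_prod]
  refine Finset.prod_congr rfl fun i _ => ?_
  split_ifs
  · exact ENNReal.toReal_ofReal (f i).2.1
  · exact ENNReal.toReal_ofReal (sub_nonneg.2 (f i).2.2)

/-- Independence of the coins, as a formula for the expectation of a product. -/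
theorem sum_randomSubset_mul_prod (f : α → unitInterval) (φ ψ : α → ENNReal) :
    ∑ T, randomSubset f T * (∏ i, if i ∈ T then φ i else ψ i) =
      ∏ i, (ENNReal.ofReal (f i) * φ i + ENNReal.ofReal (1 - (f i : ℝ)) * ψ i) := by
  rw [Fintype.prod_add]
  refine Finset.sum_congr rfl fun T _ => ?_
  rw [randomSubset_apply, ← Finset.prod_mul_distrib, ← Finset.prod_mul_prod_compl T]
  congr 1
  · exact Finset.prod_congr rfl fun i hi => by simp [hi]
  · exact Finset.prod_congr rfl fun i hi => by simp [Finset.mem_compl.1 hi]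

theorem sum_toReal_randomSubset_mul_prod (f : α → unitInterval) (φ ψ : α → ℝ) :
    ∑ T, (randomSubset f T).toReal * (∏ i, if i ∈ T then φ i else ψ i) =
      ∏ i, ((f i : ℝ) * φ i + (1 - (f i : ℝ)) * ψ i) := by
  rw [Fintype.prod_add]
  refine Finset.sum_congr rfl fun T _ => ?_
  rw [toReal_randomSubset_apply, ← Finset.prod_mul_distrib, ← Finset.prod_mul_prod_compl T]
  congr 1
  · exact Finset.prod_congr rfl fun i hi => by simp [hi]
  · exact Finset.prod_congr rfl fun i hi => by simp [Finset.mem_compl.1 hi]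

/-- The intersection of two independent random subsets. -/
theorem randomSubset_bind_inter (f g : α → unitInterval) :
    ((randomSubset f).bind fun S => (randomSubset g).map fun T => S ∩ T) =
      randomSubset fun i => f i * g i := by
  classical
  ext U
  have h1 : ∀ S : Finset α, ((randomSubset g).map fun T => S ∩ T) U =
      ∏ i, if i ∈ S then (if i ∈ U then ENNReal.ofReal (g i) else ENNReal.ofReal (1 - (g i : ℝ)))
        else if i ∈ U then 0 else 1 := by
    intro S
    have key := sum_randomSubset_mul_prod g
      (fun i => if i ∈ S then (if i ∈ U then 1 else 0) else if i ∈ U then 0 else 1)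
      (fun i => if i ∈ U then 0 else 1)
    rw [PMF.map_apply, tsum_fintype]
    convert key using 1
    · refine Finset.sum_congr rfl fun T _ => ?_
      have : (∏ i, if i ∈ T then
          ((if i ∈ S then (if i ∈ U then 1 else 0) else if i ∈ U then 0 else 1) : ENNReal)
          else if i ∈ U then 0 else 1) = ∏ i, if (i ∈ U ↔ i ∈ S ∧ i ∈ T) then 1 else 0 :=
        Finset.prod_congr rfl fun i _ => by split_ifs <;> tauto
      rw [this, Fintype.prod_boole]
      by_cases hU : U = S ∩ T
      · simp [hU]
      · have : ¬ ∀ i, (i ∈ U ↔ i ∈ S ∧ i ∈ T) := fun h => hU (by ext i; simpa using h i)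
        simp [hU, this]
    · refine Finset.prod_congr rfl fun i _ => ?_
      have : ENNReal.ofReal (g i) + ENNReal.ofReal (1 - (g i : ℝ)) = 1 := by
        rw [← ENNReal.ofReal_add (g i).2.1 (sub_nonneg.2 (g i).2.2)]; simp
      split_ifs <;> simp [this]
  rw [PMF.bind_apply, tsum_fintype]
  simp_rw [h1]
  rw [sum_randomSubset_mul_prod, randomSubset_apply]
  refine Finset.prod_congr rfl fun i _ => ?_
  have hf := (f i).2
  have hg := (g i).2
  by_cases hi : i ∈ U
  · simp [hi, ENNReal.ofReal_mul hf.1]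
  · simp only [hi, if_false, mul_one]
    rw [← ENNReal.ofReal_mul hf.1]
    rw [← ENNReal.ofReal_add (mul_nonneg hf.1 (sub_nonneg.2 hg.2)) (sub_nonneg.2 hf.2)]
    congr 1
    simp only [Set.Icc.coe_mul]
    ring

theorem map_randomSubset_equiv {β : Type*} [Fintype β] [DecidableEq β] (e : α ≃ β)
    (f : α → unitInterval) :
    (randomSubset f).map (fun T => T.map e.toEmbedding) = randomSubset fun j => f (e.symm j) := by
  ext U
  rw [PMF.map_apply, tsum_fintype, Finset.sum_eq_single (U.map e.symm.toEmbedding)]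
  · rw [if_pos (by ext; simp), randomSubset_apply, randomSubset_apply]
    refine Fintype.prod_equiv e _ _ fun i => ?_
    simp
  · rintro T - hT
    refine if_neg fun h => hT ?_
    rw [h]; ext; simp
  · simp

end RandomSubset

/-! ### Subsampling and relabelling of random graphs -/

section Graphs

variable {n : ℕ}

/-- The action of a permutation on unordered pairs. -/
def pairPerm (π : Equiv.Perm (Fin n)) : Equiv.Perm (Sym2 (Fin n)) where
  toFun := Sym2.map π
  invFun := Sym2.map π.symm
  left_inv e := by simp [Sym2.map_map]
  right_inv e := by simp [Sym2.map_map]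

@[simp] theorem pairPerm_apply (π : Equiv.Perm (Fin n)) (e : Sym2 (Fin n)) :
    pairPerm π e = e.map π := rfl

@[simp] theorem pairPerm_symm_apply (π : Equiv.Perm (Fin n)) (e : Sym2 (Fin n)) :
    (pairPerm π).symm e = e.map π.symm := rfl

theorem map_perm_adj (π : Equiv.Perm (Fin n)) (G : SimpleGraph (Fin n)) (u v : Fin n) :
    (G.map π).Adj u v ↔ G.Adj (π.symm u) (π.symm v) := by
  rw [SimpleGraph.map_adj']
  constructor
  · rintro ⟨-, u, v, h, rfl, rfl⟩
    simpa using h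
  · intro h
    exact ⟨fun he => h.ne (by rw [he]), _, _, h, by simp, by simp⟩

theorem fromEdgeSet_map_perm (π : Equiv.Perm (Fin n)) (T : Finset (Sym2 (Fin n))) :
    (SimpleGraph.fromEdgeSet (T : Set (Sym2 (Fin n)))).map π =
      SimpleGraph.fromEdgeSet (T.map (pairPerm π).toEmbedding : Set (Sym2 (Fin n))) := by
  ext u v
  have h : s(u, v) ∈ T.map (pairPerm π).toEmbedding ↔ s(π.symm u, π.symm v) ∈ T := by
    rw [Finset.mem_map_equiv]; rfl
  rw [map_perm_adj, SimpleGraph.fromEdgeSet_adj, SimpleGraph.fromEdgeSet_adj, Finset.mem_coe,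
    Finset.mem_coe, h]
  simp

theorem sbm_eq_map {C : ℕ} (σ : Fin n → Fin C) (p q : unitInterval) :
    sbm σ p q = (randomSubset fun e : Sym2 (Fin n) => if (e.map σ).IsDiag then p else q).map
      fun T : Finset (Sym2 (Fin n)) => SimpleGraph.fromEdgeSet (T : Set (Sym2 (Fin n))) :=
  PMF.map_comp (fun T : Finset (Sym2 (Fin n)) => (T : Set (Sym2 (Fin n)))) _ _

theorem subsample_eq_map (s : unitInterval) (G : SimpleGraph (Fin n)) :
    subsample s G = (randomSubset fun _ : Sym2 (Fin n) => s).map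
      fun T : Finset (Sym2 (Fin n)) =>
        SimpleGraph.fromEdgeSet (G.edgeSet ∩ (T : Set (Sym2 (Fin n)))) :=
  PMF.map_comp (fun T : Finset (Sym2 (Fin n)) => (T : Set (Sym2 (Fin n)))) _ _

theorem subsample_fromEdgeSet (s : unitInterval) (S : Finset (Sym2 (Fin n))) :
    subsample s (SimpleGraph.fromEdgeSet (S : Set (Sym2 (Fin n)))) =
      (randomSubset fun _ : Sym2 (Fin n) => s).map
        fun T => SimpleGraph.fromEdgeSet
          ((S ∩ T : Finset (Sym2 (Fin n))) : Set (Sym2 (Fin n))) := by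
  rw [subsample_eq_map]
  congr 1
  ext1 T
  ext u v
  simp

theorem exists_eq_fromEdgeSet (G : SimpleGraph (Fin n)) :
    ∃ S : Finset (Sym2 (Fin n)), G = SimpleGraph.fromEdgeSet (S : Set (Sym2 (Fin n))) := by
  classical
  exact ⟨G.edgeFinset, by simp⟩

/-- Subsampling twice is subsampling once with the product of the probabilities. -/
theorem subsample_bind_subsample (s t : unitInterval) (G : SimpleGraph (Fin n)) :
    (subsample s G).bind (subsample t) = subsample (s * t) G := by
  obtain ⟨S, rfl⟩ := exists_eq_fromEdgeSet G
  rw [subsample_fromEdgeSet, subsample_fromEdgeSet, PMF.bind_map, ← randomSubset_bind_inter,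
    PMF.map_bind]
  congr 1
  ext1 T
  rw [Function.comp_apply, subsample_fromEdgeSet, PMF.map_comp]
  congr 1
  ext1 U
  simp [Finset.inter_assoc]

/-- Subsampling turns a stochastic block model into a sparser one. -/
theorem sbm_bind_subsample {C : ℕ} (σ : Fin n → Fin C) (p q s : unitInterval) :
    (sbm σ p q).bind (subsample s) = sbm σ (p * s) (q * s) := by
  simp only [sbm_eq_map]
  have : (fun e : Sym2 (Fin n) => if (e.map σ).IsDiag then p * s else q * s) =
      fun e => (if (e.map σ).IsDiag then p else q) * s := by
    ext1 e; split_ifs <;> rfl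
  rw [this, ← randomSubset_bind_inter, PMF.bind_map, PMF.map_bind]
  congr 1
  ext1 T
  rw [Function.comp_apply, subsample_fromEdgeSet, PMF.map_comp]
  rfl

theorem subsample_map_perm (π : Equiv.Perm (Fin n)) (s : unitInterval) (G : SimpleGraph (Fin n)) :
    subsample s (G.map π) = (subsample s G).map fun H => H.map π := by
  obtain ⟨S, rfl⟩ := exists_eq_fromEdgeSet G
  rw [fromEdgeSet_map_perm, subsample_fromEdgeSet, subsample_fromEdgeSet, PMF.map_comp]
  conv_lhs => rw [← map_randomSubset_equiv (pairPerm π) (fun _ => s), PMF.map_comp]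
  congr 1
  ext1 T
  rw [Function.comp_apply, Function.comp_apply, fromEdgeSet_map_perm, Finset.map_inter]

theorem sbm_map_perm {C : ℕ} (π : Equiv.Perm (Fin n)) (σ : Fin n → Fin C) (p q : unitInterval) :
    (sbm σ p q).map (fun H => H.map π) = sbm (fun v => σ (π.symm v)) p q := by
  simp only [sbm_eq_map]
  have : (fun e : Sym2 (Fin n) => if (e.map fun v => σ (π.symm v)).IsDiag then p else q) =
      fun e => if (((pairPerm π).symm e).map σ).IsDiag then p else q := by
    ext1 e
    induction e with | _ u v => simp [pairPerm]
  rw [this, ← map_randomSubset_equiv (pairPerm π)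
    (fun e => if (e.map σ).IsDiag then p else q), PMF.map_comp, PMF.map_comp]
  congr 1
  ext1 T
  rw [Function.comp_apply, Function.comp_apply, fromEdgeSet_map_perm]

end Graphs

/-! ### The law of the released graph -/

section Laws

theorem map_uniformOfFintype_equiv {α : Type*} [Fintype α] [Nonempty α] (e : α ≃ α) :
    (PMF.uniformOfFintype α).map e = PMF.uniformOfFintype α := by
  ext x
  rw [PMF.map_apply, tsum_eq_single (e.symm x)]
  · simp
  · intro y hy
    exact if_neg fun h => hy (by simp [h])

/-- Relabelling the vertices permutes the balanced labelings. -/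
def permLabeling (C m : ℕ) (π : Equiv.Perm (Fin (C * m))) : Equiv.Perm (BalancedLabeling C m) where
  toFun σ := ⟨fun v => σ.1 (π.symm v), fun k => 
    (Fintype.card_congr (π.symm.subtypeEquiv fun v => Iff.rfl)).trans (σ.2 k)⟩
  invFun σ := ⟨fun v => σ.1 (π v), fun k => 
    (Fintype.card_congr (π.subtypeEquiv fun v => Iff.rfl)).trans (σ.2 k)⟩
  left_inv σ := by ext; simp
  right_inv σ := by ext; simp

theorem sensLaw_eq_sbm (C : ℕ) (a b : ℝ) (s : unitInterval) (m : ℕ) :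
    sensLaw C a b s m = (PMF.uniformOfFintype (BalancedLabeling C m)).bind fun σ =>
      (sbm σ.1 (edgeProb a (C * m) * s) (edgeProb b (C * m) * s)).map fun H => (σ.1, H) := by
  simp only [sensLaw, ← sbm_bind_subsample, PMF.map_bind]

/-- The released graph with its labels is distributed as a sensitive graph which is subsampled with
probability `s₂ * t`: the anonymization is invisible, as the labels are uniform. -/
theorem releasedLaw_eq_sensLaw (C : ℕ) (a b : ℝ) (s₁ s₂ t : unitInterval) (m : ℕ) :
    releasedLaw C a b s₁ s₂ t m = sensLaw C a b (s₂ * t) m := by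
  have h : releasedLaw C a b s₁ s₂ t m =
      (PMF.uniformOfFintype (BalancedLabeling C m)).bind fun σ =>
      (PMF.uniformOfFintype (Equiv.Perm (Fin (C * m)))).bind fun π =>
      (sbm (permLabeling C m π σ).1 (edgeProb a (C * m) * (s₂ * t))
        (edgeProb b (C * m) * (s₂ * t))).map fun H => ((permLabeling C m π σ).1, H) := by
    simp only [releasedLaw, model, PMF.map_bind, PMF.map_comp]
    congr 1
    ext1 σ
    change ((sbm σ.1 _ _).bind fun G => (subsample s₁ G).bind fun _ => (subsample s₂ G).bind
      fun G₂ => (PMF.uniformOfFintype (Equiv.Perm (Fin (C * m)))).bind fun π =>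
      (subsample t (G₂.map π)).map fun H => ((fun v => σ.1 (π.symm v)), H)) = _
    simp only [PMF.bind_const, subsample_map_perm, PMF.map_comp, Function.comp_def]
    have h1 : ∀ G, ((subsample s₂ G).bind fun G₂ =>
        (PMF.uniformOfFintype (Equiv.Perm (Fin (C * m)))).bind fun π =>
        (subsample t G₂).map fun H => ((fun v => σ.1 (π.symm v)), H.map π)) =
        (PMF.uniformOfFintype (Equiv.Perm (Fin (C * m)))).bind fun π =>
        (subsample (s₂ * t) G).map fun H => ((fun v => σ.1 (π.symm v)), H.map π) := by
      intro G
      rw [PMF.bind_comm]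
      simp only [← PMF.map_bind]
      rw [subsample_bind_subsample]
    simp only [h1]
    rw [PMF.bind_comm]
    congr 1
    ext1 π
    rw [← PMF.map_bind, sbm_bind_subsample]
    change _ = (sbm (fun v => σ.1 (π.symm v)) _ _).map _
    rw [← sbm_map_perm, PMF.map_comp]
    rfl
  rw [h, PMF.bind_comm, sensLaw_eq_sbm]
  refine Eq.trans ?_ (PMF.bind_const (PMF.uniformOfFintype (Equiv.Perm (Fin (C * m)))) _)
  congr 1
  ext1 π
  conv_rhs => rw [← map_uniformOfFintype_equiv (permLabeling C m π), PMF.bind_map]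
  rfl

end Laws

/-! ### Probabilities of events -/

section Prob

variable {α β : Type*}

theorem prob_map (μ : PMF α) (f : α → β) (E : Set β) : prob (μ.map f) E = prob μ (f ⁻¹' E) :=
  PMF.toOuterMeasure_map_apply f μ E

theorem prob_bind (μ : PMF α) (f : α → PMF β) (E : Set β) :
    prob (μ.bind f) E = ∑' a, μ a * prob (f a) E :=
  PMF.toOuterMeasure_bind_apply μ f E

theorem prob_bind_le (μ : PMF α) (f : α → PMF β) (E : Set β) (c : ENNReal)
    (h : ∀ a, prob (f a) E ≤ c) : prob (μ.bind f) E ≤ c := by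
  rw [prob_bind]
  calc ∑' a, μ a * prob (f a) E ≤ ∑' a, μ a * c := by gcongr; exact h _
    _ = c := by rw [ENNReal.tsum_mul_right, PMF.tsum_coe, one_mul]

theorem le_prob_bind (μ : PMF α) (f : α → PMF β) (E : Set β) (c : ENNReal)
    (h : ∀ a, c ≤ prob (f a) E) : c ≤ prob (μ.bind f) E := by
  rw [prob_bind]
  calc c = ∑' a, μ a * c := by rw [ENNReal.tsum_mul_right, PMF.tsum_coe, one_mul]
    _ ≤ ∑' a, μ a * prob (f a) E := by gcongr; exact h _

theorem prob_univ (μ : PMF α) : prob μ Set.univ = 1 :=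
  (PMF.toOuterMeasure_apply_eq_one_iff μ _).2 (Set.subset_univ _)

theorem prob_mono (μ : PMF α) {E F : Set α} (h : E ⊆ F) : prob μ E ≤ prob μ F :=
  MeasureTheory.measure_mono h

theorem prob_le_one (μ : PMF α) (E : Set α) : prob μ E ≤ 1 :=
  (prob_mono μ (Set.subset_univ E)).trans (prob_univ μ).le

theorem one_sub_prob_compl_le (μ : PMF α) (E : Set α) : 1 - prob μ Eᶜ ≤ prob μ E := by
  rw [tsub_le_iff_right, ← prob_univ μ, ← Set.union_compl_self E]
  exact MeasureTheory.measure_union_le _ _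

open Classical in
theorem prob_eq_ofReal_sum [Fintype α] (μ : PMF α) (E : Set α) :
    prob μ E = ENNReal.ofReal (∑ x, if x ∈ E then (μ x).toReal else 0) := by
  rw [prob, PMF.toOuterMeasure_apply_fintype, ENNReal.ofReal_sum_of_nonneg]
  · refine Finset.sum_congr rfl fun x _ => ?_
    by_cases hx : x ∈ E <;> simp [hx, μ.apply_ne_top x]
  · intro x _
    split_ifs <;> simp

/-- Markov's inequality for a nonnegative function which is at least `1` on the event. -/
theorem prob_le_ofReal_sum [Fintype α] (μ : PMF α) (E : Set α) (g : α → ℝ) (h0 : ∀ x, 0 ≤ g x)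
    (h1 : ∀ x ∈ E, 1 ≤ g x) : prob μ E ≤ ENNReal.ofReal (∑ x, (μ x).toReal * g x) := by
  classical
  rw [prob_eq_ofReal_sum]
  gcongr with x _
  split_ifs with hx
  · exact le_mul_of_one_le_right ENNReal.toReal_nonneg (h1 x hx)
  · exact mul_nonneg ENNReal.toReal_nonneg (h0 x)

end Prob

/-! ### Cuts and the pairs separated by a labeling -/

section Cuts

variable {n : ℕ}

/-- The pairs of vertices which are in the same community for `σ`, but not for `τ`. -/
def sepPairs (σ τ : Fin n → Fin 2) : Finset (Sym2 (Fin n)) :=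
  {e | (e.map σ).IsDiag ∧ ¬ (e.map τ).IsDiag}

/-- The label of a community as a sign. -/
def communitySign (i : Fin 2) : ℝ := if i = 0 then 1 else -1

/-- Both sides count the ordered separated pairs. -/
theorem two_mul_card_sepPairs (σ τ : Fin n → Fin 2) :
    2 * (#(sepPairs σ τ) : ℝ) = ∑ u, ∑ v,
      (1 + communitySign (σ u) * communitySign (σ v)) *
        (1 - communitySign (τ u) * communitySign (τ v)) / 4 := by
  classical
  -- the separated pairs are the edges of a graph, to which the handshake lemma applies
  set Γ : SimpleGraph (Fin n) := SimpleGraph.fromEdgeSet (sepPairs σ τ : Set (Sym2 (Fin n))) with hΓ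
  have hE : Γ.edgeFinset = sepPairs σ τ := by
    ext e
    rw [SimpleGraph.mem_edgeFinset, hΓ, SimpleGraph.edgeSet_fromEdgeSet]
    induction e with | _ u v =>
    simp only [Set.mem_sdiff, Finset.mem_coe, Sym2.mem_diagSet, and_iff_left_iff_imp, sepPairs,
      Finset.mem_filter, Finset.mem_univ, true_and, Sym2.map_mk, Sym2.mk_isDiag_iff]
    rintro ⟨-, h⟩ rfl
    exact h rfl
  have hdeg : ∑ u, Γ.degree u = 2 * #(sepPairs σ τ) := by
    refine Eq.trans ?_ (congrArg (fun S => 2 * #S) hE)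
    convert Γ.sum_degrees_eq_twice_card_edges
  have : (2 * (#(sepPairs σ τ) : ℝ)) = ∑ u, (Γ.degree u : ℝ) := by exact_mod_cast hdeg.symm
  rw [this]
  refine Finset.sum_congr rfl fun u _ => ?_
  rw [← SimpleGraph.card_neighborFinset_eq_degree, SimpleGraph.neighborFinset_eq_filter,
    Finset.card_filter, Nat.cast_sum]
  refine Finset.sum_congr rfl fun v _ => ?_
  have hadj : Γ.Adj u v ↔ σ u = σ v ∧ τ u ≠ τ v := by
    simp only [hΓ, SimpleGraph.fromEdgeSet_adj, Finset.mem_coe, sepPairs, Finset.mem_filter,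
      Finset.mem_univ, true_and, Sym2.map_mk, Sym2.mk_isDiag_iff]
    refine ⟨fun h => h.1, fun h => ⟨h, ?_⟩⟩
    rintro rfl
    exact h.2 rfl
  simp only [hadj]
  generalize σ u = i
  generalize σ v = j
  generalize τ u = k
  generalize τ v = l
  fin_cases i <;> fin_cases j <;> fin_cases k <;> fin_cases l <;> norm_num [communitySign]

theorem sum_communitySign {m : ℕ} (σ : BalancedLabeling 2 m) :
    ∑ v, communitySign (σ.1 v) = 0 := by
  rw [← Finset.sum_fiberwise' Finset.univ σ.1 communitySign]
  have h : ∀ k, #{v | σ.1 v = k} = m := fun k => by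
    rw [← Fintype.card_subtype]; exact σ.2 k
  simp [h, communitySign]

/-- If two balanced labelings of `n` vertices disagree on `d` of them, then `d (n - d) / 2` pairs
are together in the first and apart in the second. -/
theorem card_sepPairs {m : ℕ} (σ τ : BalancedLabeling 2 m) :
    2 * (#(sepPairs σ.1 τ.1) : ℝ) =
      #{v | τ.1 v ≠ σ.1 v} * (((2 * m : ℕ) : ℝ) - #{v | τ.1 v ≠ σ.1 v}) := by
  have hd : ∑ v, communitySign (σ.1 v) * communitySign (τ.1 v) =
      ((2 * m : ℕ) : ℝ) - 2 * #{v | τ.1 v ≠ σ.1 v} := by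
    have : ∀ v, communitySign (σ.1 v) * communitySign (τ.1 v) =
        1 - 2 * if τ.1 v ≠ σ.1 v then 1 else 0 := by
      intro v
      generalize σ.1 v = i
      generalize τ.1 v = j
      fin_cases i <;> fin_cases j <;> norm_num [communitySign]
    simp only [this, Finset.sum_sub_distrib, ← Finset.mul_sum, Finset.card_filter]
    simp
  -- the double sum factorizes into sums over vertices, of which the balanced ones vanish
  have h2 : 2 * (#(sepPairs σ.1 τ.1) : ℝ) = (((2 * m : ℕ) : ℝ) * ((2 * m : ℕ) : ℝ) +
      (∑ v, communitySign (σ.1 v)) * (∑ v, communitySign (σ.1 v)) -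
      (∑ v, communitySign (τ.1 v)) * (∑ v, communitySign (τ.1 v)) -
      (∑ v, communitySign (σ.1 v) * communitySign (τ.1 v)) *
        (∑ v, communitySign (σ.1 v) * communitySign (τ.1 v))) / 4 := by
    rw [two_mul_card_sepPairs]
    have hn : (((2 * m : ℕ) : ℝ) * ((2 * m : ℕ) : ℝ)) =
        ∑ u : Fin (2 * m), ∑ v : Fin (2 * m), (1 : ℝ) := by simp
    rw [hn]
    simp only [Finset.sum_mul_sum, ← Finset.sum_add_distrib, ← Finset.sum_sub_distrib,
      ← Finset.sum_div]
    congr 1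
    refine Finset.sum_congr rfl fun u _ => Finset.sum_congr rfl fun v _ => ?_
    ring
  rw [h2, sum_communitySign, sum_communitySign, hd]
  ring

open Classical in
/-- The number of edges of `G` between different communities. -/
noncomputable def cutSize (G : SimpleGraph (Fin n)) (τ : Fin n → Fin 2) : ℕ :=
  #{e | e ∈ G.edgeSet ∧ ¬ (e.map τ).IsDiag}

/-- The cut of `τ` splits into the pairs which `σ` does not separate and those which it does. -/
theorem cutSize_fromEdgeSet (T : Finset (Sym2 (Fin n))) (σ τ : Fin n → Fin 2) :
    cutSize (SimpleGraph.fromEdgeSet (T : Set (Sym2 (Fin n)))) τ =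
      #(T ∩ sepPairs σ τ) + #{e ∈ T | ¬ (e.map σ).IsDiag ∧ ¬ (e.map τ).IsDiag} := by
  classical
  rw [cutSize, ← Finset.card_union_of_disjoint]
  · congr 1
    ext e
    have : e.IsDiag → (e.map τ).IsDiag := by
      induction e with | _ u v => simp only [Sym2.map_mk, Sym2.mk_isDiag_iff]; rintro rfl; rfl
    simp only [SimpleGraph.edgeSet_fromEdgeSet, Set.mem_sdiff, Finset.mem_coe, Sym2.mem_diagSet,
      Finset.mem_filter, Finset.mem_univ, true_and, Finset.mem_union, Finset.mem_inter, sepPairs]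
    tauto
  · rw [Finset.disjoint_left]
    intro e
    simp only [sepPairs, Finset.mem_inter, Finset.mem_filter]
    tauto

theorem card_inter_sepPairs_le {T : Finset (Sym2 (Fin n))} {σ τ : Fin n → Fin 2}
    (h : cutSize (SimpleGraph.fromEdgeSet (T : Set (Sym2 (Fin n)))) τ ≤
      cutSize (SimpleGraph.fromEdgeSet (T : Set (Sym2 (Fin n)))) σ) :
    #(T ∩ sepPairs σ τ) ≤ #(T ∩ sepPairs τ σ) := by
  rw [cutSize_fromEdgeSet T σ τ, cutSize_fromEdgeSet T τ σ] at h
  simp only [and_comm (a := ¬ (Sym2.map σ _).IsDiag)] at h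
  omega

/-- The Chernoff bound for the event that `τ` cuts no more edges than the true labeling `σ`, with
exponential tilt `z`. -/
theorem prob_cutSize_le (σ τ : Fin n → Fin 2) (p q : unitInterval) {z : ℝ} (hz : 1 ≤ z) :
    prob (sbm σ p q) {G | cutSize G τ ≤ cutSize G σ} ≤
      ENNReal.ofReal (Real.exp (#(sepPairs σ τ) * (p * (z⁻¹ - 1)) +
        #(sepPairs τ σ) * (q * (z - 1)))) := by
  have hz0 : 0 < z := by linarith
  rw [sbm_eq_map, prob_map]
  -- `∏ e ∈ T, φ e` is `z` to the power of the difference of the two cuts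
  let φ : Sym2 (Fin n) → ℝ := fun e =>
    (if e ∈ sepPairs σ τ then z⁻¹ else 1) * (if e ∈ sepPairs τ σ then z else 1)
  have hφ : ∀ e, 0 ≤ φ e := fun e => by
    refine mul_nonneg ?_ ?_ <;> split_ifs <;> positivity
  refine (prob_le_ofReal_sum _ _ (fun T => ∏ e, if e ∈ T then φ e else 1)
    (fun T => Finset.prod_nonneg fun e _ => by split_ifs <;> simp [hφ]) ?_).trans ?_
  · intro T hT
    have hT' := card_inter_sepPairs_le hT
    have : (∏ e, if e ∈ T then φ e else 1) =
        z⁻¹ ^ #(T ∩ sepPairs σ τ) * z ^ #(T ∩ sepPairs τ σ) := by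
      rw [← Finset.prod_filter, Finset.prod_mul_distrib]
      congr 1
      · rw [← Finset.prod_filter, Finset.prod_const]; congr 2; ext; simp
      · rw [← Finset.prod_filter, Finset.prod_const]; congr 2; ext; simp
    rw [this, inv_pow, inv_mul_eq_div, one_le_div (by positivity)]
    exact pow_le_pow_right₀ hz hT'
  · refine ENNReal.ofReal_le_ofReal ?_
    rw [sum_toReal_randomSubset_mul_prod]
    have hexp : ∀ e : Sym2 (Fin n),
        (((if (e.map σ).IsDiag then p else q : unitInterval) : ℝ) * φ e +
          (1 - ((if (e.map σ).IsDiag then p else q : unitInterval) : ℝ)) * 1) ≤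
        Real.exp ((if e ∈ sepPairs σ τ then p * (z⁻¹ - 1) else 0) +
          (if e ∈ sepPairs τ σ then q * (z - 1) else 0)) := by
      intro e
      refine le_trans (le_of_eq ?_) (Real.add_one_le_exp _)
      by_cases h1 : (e.map σ).IsDiag <;> by_cases h2 : (e.map τ).IsDiag <;>
        simp [φ, sepPairs, h1, h2] <;> ring
    refine (Finset.prod_le_prod (fun e _ => ?_) fun e _ => hexp e).trans (le_of_eq ?_)
    · have := (if (e.map σ).IsDiag then p else q).2
      exact add_nonneg (mul_nonneg this.1 (hφ e)) (mul_nonneg (sub_nonneg.2 this.2) zero_le_one)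
    · rw [← Real.exp_sum, Finset.sum_add_distrib]
      simp

end Cuts

/-! ### Analytic estimates for recovery -/

/-- The optimal exponential tilt: above the threshold some `z ≥ 1` gives an exponent larger
than `2`. -/
theorem exists_tilt {a b s : ℝ} (hb : 0 ≤ b) (hab : b < a)
    (h : 2 < s * (√a - √b) ^ 2) :
    ∃ z : ℝ, 1 ≤ z ∧ 2 < s * (a * (1 - z⁻¹) - b * (z - 1)) := by
  have ha : 0 < a := hb.trans_lt hab
  rcases hb.eq_or_lt with rfl | hb
  · rw [Real.sqrt_zero, sub_zero, Real.sq_sqrt ha.le] at h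
    -- for `b = 0` the infimum over `z` is not attained
    refine ⟨2 * (s * a) / (s * a - 2), ?_, ?_⟩
    · rw [one_le_div (by linarith)]; linarith
    · have : s * (a * (1 - (2 * (s * a) / (s * a - 2))⁻¹) -
          0 * (2 * (s * a) / (s * a - 2) - 1)) = (s * a + 2) / 2 := by
        have h1 : s * a ≠ 0 := by linarith
        have hs : s ≠ 0 := left_ne_zero_of_mul h1
        rw [inv_div]
        field_simp
        ring
      rw [this]; linarith
  · have h1 : 0 < √a := Real.sqrt_pos.2 ha
    have h2 : 0 < √b := Real.sqrt_pos.2 hb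
    refine ⟨√a / √b, ?_, ?_⟩
    · rw [one_le_div h2]; exact Real.sqrt_le_sqrt hab.le
    · have : a * (1 - (√a / √b)⁻¹) - b * (√a / √b - 1) = (√a - √b) ^ 2 := by
        have ha2 := Real.sq_sqrt ha.le
        have hb2 := Real.sq_sqrt hb.le
        have e1 : a * (1 - (√a / √b)⁻¹) = √a ^ 2 - √a * √b := by
          conv_lhs => rw [← ha2]
          field_simp
          rw [ha2]
        have e2 : b * (√a / √b - 1) = √a * √b - √b ^ 2 := by
          conv_lhs => rw [← hb2]
          field_simp
          rw [hb2]
        rw [e1, e2]; ring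
      rwa [this]

/-- The terms of the union bound with `d ≤ n / 2` decay geometrically in `d`. Few disagreements are
controlled by the entropy bound `n ^ d`, many by the bound `2 ^ n`. -/
theorem choose_mul_exp_le {γ : ℝ} (hγ : 1 < γ) : ∃ K η : ℝ, 1 ≤ K ∧ 0 < η ∧
    ∀ n d : ℕ, 1 ≤ n → 2 * d ≤ n →
      (n.choose d : ℝ) * Real.exp (-(d * (n - d) * (γ * Real.log n / n))) ≤
        (K * Real.exp (-(η * Real.log n))) ^ d := by
  have hδ : 0 < (γ - 1) / (2 * γ) := by
    apply div_pos <;> linarith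
  -- `δ n` separates few from many disagreements: for `d ≤ δ n` the exponent `γ (1 - d / n)` is
  -- still larger than `1`, while for `d > δ n` the factor `2 ^ n` is at most `(2 ^ (1 / δ)) ^ d`
  set δ := (γ - 1) / (2 * γ) with hδdef
  refine ⟨2 ^ (1 / δ), min ((γ - 1) / 2) (1 / 2), ?_, ?_, ?_⟩
  · exact Real.one_le_rpow (by norm_num) (by positivity)
  · apply lt_min <;> linarith
  intro n d hn hd
  have hn0 : (0 : ℝ) < n := by exact_mod_cast hn
  have hL : 0 ≤ Real.log n := Real.log_natCast_nonneg n
  have hd2 : 2 * (d : ℝ) ≤ n := by exact_mod_cast hd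
  have hd0 : (0 : ℝ) ≤ d := Nat.cast_nonneg d
  set η := min ((γ - 1) / 2) (1 / 2) with hη
  have hη1 : η ≤ (γ - 1) / 2 := min_le_left _ _
  have hη2 : η ≤ 1 / 2 := min_le_right _ _
  have hK : (1 : ℝ) ≤ 2 ^ (1 / δ) := Real.one_le_rpow (by norm_num) (by positivity)
  have hexp : (d : ℝ) * (n - d) * (γ * Real.log n / n) =
      d * (γ * (1 - d / n)) * Real.log n := by field_simp
  rw [hexp, mul_pow, ← Real.exp_nat_mul]
  rcases le_or_gt (d : ℝ) (δ * n) with hc | hc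
  · have h1 : (n.choose d : ℝ) ≤ Real.exp (d * Real.log n) := by
      rw [Real.exp_nat_mul, Real.exp_log hn0]
      exact_mod_cast Nat.choose_le_pow n d
    have h2 : 1 + η ≤ γ * (1 - d / n) := by
      have : (d : ℝ) / n ≤ δ := by rwa [div_le_iff₀ hn0]
      have : γ * δ = (γ - 1) / 2 := by rw [hδdef]; field_simp
      nlinarith
    calc (n.choose d : ℝ) * Real.exp (-(d * (γ * (1 - d / n)) * Real.log n))
        ≤ Real.exp (d * Real.log n) * Real.exp (-(d * (1 + η) * Real.log n)) := by gcongr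
      _ = Real.exp (d * -(η * Real.log n)) := by rw [← Real.exp_add]; congr 1; ring
      _ ≤ _ := le_mul_of_one_le_left (Real.exp_nonneg _) (one_le_pow₀ hK)
  · have h1 : (n.choose d : ℝ) ≤ (2 ^ (1 / δ)) ^ d := by
      rw [← Real.rpow_natCast, ← Real.rpow_mul (by norm_num)]
      calc (n.choose d : ℝ) ≤ 2 ^ n := by exact_mod_cast Nat.choose_le_two_pow n d
        _ = (2 : ℝ) ^ (n : ℝ) := (Real.rpow_natCast 2 n).symm
        _ ≤ _ := by
          apply Real.rpow_le_rpow_of_exponent_le (by norm_num)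
          rw [one_div, inv_mul_eq_div, le_div_iff₀ hδ]
          linarith
    have h2 : η ≤ γ * (1 - d / n) := by
      have : (d : ℝ) / n ≤ 1 / 2 := by rw [div_le_iff₀ hn0]; linarith
      nlinarith
    gcongr
    rw [mul_neg, neg_le_neg_iff, ← mul_assoc]
    gcongr

/-- The union bound for recovery tends to `0`; `d` is the number of disagreements. -/
theorem tendsto_sum_choose_mul_exp {γ : ℝ} (hγ : 1 < γ) :
    Tendsto (fun n : ℕ => ∑ d ∈ Finset.range (n + 1), (n.choose d : ℝ) *
      if 0 < d ∧ d < n then Real.exp (-(d * (n - d) * (γ * Real.log n / n))) else 0)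
      atTop (𝓝 0) := by
  obtain ⟨K, η, hK, hη, hb⟩ := choose_mul_exp_le hγ
  set y : ℕ → ℝ := fun n => K * Real.exp (-(η * Real.log n)) with hy
  have hy0 : ∀ n, 0 ≤ y n := fun n => by positivity
  have hlim : Tendsto y atTop (𝓝 0) := by
    have h1 : Tendsto (fun n : ℕ => η * Real.log n) atTop atTop :=
      (Real.tendsto_log_atTop.comp tendsto_natCast_atTop_atTop).const_mul_atTop hη
    have h2 := (Real.tendsto_exp_neg_atTop_nhds_zero.comp h1).const_mul K
    simpa [Function.comp_def] using h2
  have hlim2 : Tendsto (fun n => 2 * (y n * (1 - y n)⁻¹)) atTop (𝓝 0) := by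
    have := (hlim.mul ((tendsto_const_nhds.sub hlim).inv₀
      (by norm_num : (1 : ℝ) - 0 ≠ 0))).const_mul 2
    simpa using this
  refine squeeze_zero' (.of_forall fun n => Finset.sum_nonneg fun d _ =>
    mul_nonneg (Nat.cast_nonneg _) (by split_ifs <;> positivity)) ?_ hlim2
  filter_upwards [hlim.eventually_lt_const (zero_lt_one), eventually_ge_atTop 1] with n hyn hn
  -- each term is bounded according to which of `d` and `n - d` is the smaller one
  have hterm : ∀ d ∈ Finset.range (n + 1), ((n.choose d : ℝ) *
      if 0 < d ∧ d < n then Real.exp (-(d * (n - d) * (γ * Real.log n / n))) else 0) ≤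
      y n * y n ^ (d - 1) * (if 0 < d then 1 else 0) +
        y n * y n ^ (n - d - 1) * (if d < n then 1 else 0) := by
    intro d hd
    by_cases h : 0 < d ∧ d < n
    · obtain ⟨e, rfl⟩ := Nat.exists_eq_add_of_lt h.2
      obtain ⟨c, rfl⟩ := Nat.exists_eq_add_of_lt h.1
      rw [if_pos h, if_pos h.1, if_pos h.2, mul_one, mul_one, ← pow_succ', ← pow_succ']
      set d := 0 + c + 1 with hdd
      set n := d + e + 1 with hnn
      have e1 : d - 1 + 1 = d := by omega
      have e2 : n - d - 1 + 1 = n - d := by omega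
      rw [e1, e2]
      rcases le_total (2 * d) n with h2 | h2
      · exact (hb n d hn h2).trans (le_add_of_nonneg_right (pow_nonneg (hy0 n) _))
      · have h3 := hb n (n - d) hn (by omega)
        rw [Nat.choose_symm h.2.le, Nat.cast_sub h.2.le] at h3
        refine le_trans (le_of_eq ?_) (h3.trans (le_add_of_nonneg_left (pow_nonneg (hy0 n) _)))
        congr 3
        ring
    · rw [if_neg h, mul_zero]
      have := hy0 n
      positivity
  have hgeom : ∀ N : ℕ, ∑ j ∈ Finset.range N, y n ^ j ≤ (1 - y n)⁻¹ := fun N => by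
    rw [← tsum_geometric_of_lt_one (hy0 n) hyn]
    exact (summable_geometric_of_lt_one (hy0 n) hyn).sum_le_tsum _ fun j _ => pow_nonneg (hy0 n) j
  refine (Finset.sum_le_sum hterm).trans ?_
  rw [Finset.sum_add_distrib, two_mul]
  have hA : ∑ d ∈ Finset.range (n + 1), y n * y n ^ (d - 1) * (if 0 < d then (1 : ℝ) else 0) =
      y n * ∑ j ∈ Finset.range n, y n ^ j := by
    rw [Finset.sum_range_succ', Finset.mul_sum]; simp
  have hB : ∑ d ∈ Finset.range (n + 1), y n * y n ^ (n - d - 1) * (if d < n then (1 : ℝ) else 0) =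
      ∑ d ∈ Finset.range (n + 1), y n * y n ^ (d - 1) * (if 0 < d then (1 : ℝ) else 0) := by
    rw [← Finset.sum_range_reflect]
    refine Finset.sum_congr rfl fun d hd => ?_
    have := Finset.mem_range.1 hd
    have e1 : n - (n + 1 - 1 - d) - 1 = d - 1 := by omega
    have e2 : n + 1 - 1 - d < n ↔ 0 < d := by omega
    simp only [e1, e2]
  rw [hB, hA]
  have := mul_le_mul_of_nonneg_left (hgeom n) (hy0 n)
  linarith

/-! ### Minimum bisection recovers the communities -/

theorem exists_minBisection {m : ℕ} (G : SimpleGraph (Fin (2 * m))) :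
    ∃ τ : BalancedLabeling 2 m, ∀ σ : BalancedLabeling 2 m, cutSize G τ.1 ≤ cutSize G σ.1 :=
  Finite.exists_min fun τ : BalancedLabeling 2 m => cutSize G τ.1

/-- A balanced labeling which cuts as few edges of `G` as possible. -/
noncomputable def minBisection {m : ℕ} (G : SimpleGraph (Fin (2 * m))) : BalancedLabeling 2 m :=
  (exists_minBisection G).choose

theorem cutSize_minBisection_le {m : ℕ} (G : SimpleGraph (Fin (2 * m)))
    (σ : BalancedLabeling 2 m) : cutSize G (minBisection G).1 ≤ cutSize G σ.1 :=
  (exists_minBisection G).choose_spec σ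

/-- Two labelings which agree everywhere or nowhere define the same communities. -/
theorem sameCommunities_of_disagreement {n : ℕ} {σ τ : Fin n → Fin 2}
    (h : #{v | τ v ≠ σ v} = 0 ∨ #{v | τ v ≠ σ v} = n) : SameCommunities σ τ := by
  rcases h with h | h
  · refine ⟨1, fun v => ?_⟩
    rw [Finset.card_eq_zero, Finset.filter_eq_empty_iff] at h
    simpa using h (Finset.mem_univ v)
  · refine ⟨Equiv.swap 0 1, fun v => ?_⟩
    have h' : #{v | τ v ≠ σ v} = #(Finset.univ : Finset (Fin n)) := by simpa using h
    rw [Finset.card_filter_eq_iff] at h'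
    have := h' v (Finset.mem_univ v)
    revert this
    generalize σ v = i
    generalize τ v = j
    fin_cases i <;> fin_cases j <;> simp

theorem disagreement_injective {n : ℕ} (σ : Fin n → Fin 2) :
    Function.Injective fun τ : Fin n → Fin 2 => ({v | τ v ≠ σ v} : Finset (Fin n)) := by
  intro τ τ' h
  ext1 v
  have : τ v ≠ σ v ↔ τ' v ≠ σ v := by
    have := Finset.ext_iff.1 h v
    simpa using this
  revert this
  generalize σ v = i
  generalize τ v = j
  generalize τ' v = k
  fin_cases i <;> fin_cases j <;> fin_cases k <;> simp

/-- The union bound over all competing labelings, grouped by the number of disagreements. -/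
theorem prob_not_sameCommunities_minBisection_le {m : ℕ} (σ : BalancedLabeling 2 m)
    (p q : unitInterval) {z : ℝ} (hz : 1 ≤ z) :
    prob (sbm σ.1 p q) {G | ¬ SameCommunities σ.1 (minBisection G).1} ≤
      ENNReal.ofReal (∑ d ∈ Finset.range (2 * m + 1), ((2 * m).choose d : ℝ) *
        if 0 < d ∧ d < 2 * m then
          Real.exp (-(d * ((2 * m : ℕ) - d) * ((p * (1 - z⁻¹) - q * (z - 1)) / 2))) else 0) := by
  classical
  set F : ℕ → ℝ := fun d => if 0 < d ∧ d < 2 * m then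
    Real.exp (-(d * ((2 * m : ℕ) - d) * ((p * (1 - z⁻¹) - q * (z - 1)) / 2))) else 0 with hF
  have hF0 : ∀ d, 0 ≤ F d := fun d => by simp only [hF]; split_ifs <;> positivity
  let bad : Finset (BalancedLabeling 2 m) := {τ | ¬ SameCommunities σ.1 τ.1}
  have hsub : {G | ¬ SameCommunities σ.1 (minBisection G).1} ⊆
      ⋃ τ ∈ bad, {G : SimpleGraph (Fin (2 * m)) | cutSize G τ.1 ≤ cutSize G σ.1} := by
    intro G hG
    simp only [Set.mem_iUnion]
    exact ⟨minBisection G, by simpa [bad] using hG, cutSize_minBisection_le G σ⟩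
  refine (prob_mono _ hsub).trans ((MeasureTheory.measure_biUnion_finset_le bad _).trans ?_)
  have hterm : ∀ τ ∈ bad, (sbm σ.1 p q).toOuterMeasure {G | cutSize G τ.1 ≤ cutSize G σ.1} ≤
      ENNReal.ofReal (F #{v | τ.1 v ≠ σ.1 v}) := by
    intro τ hτ
    refine (prob_cutSize_le σ.1 τ.1 p q hz).trans (ENNReal.ofReal_le_ofReal ?_)
    have hτ' : ¬ SameCommunities σ.1 τ.1 := by simpa [bad] using hτ
    have hle : #{v | τ.1 v ≠ σ.1 v} ≤ 2 * m := by
      simpa using Finset.card_filter_le (Finset.univ : Finset (Fin (2 * m))) fun v => τ.1 v ≠ σ.1 v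
    have h1 : 0 < #{v | τ.1 v ≠ σ.1 v} ∧ #{v | τ.1 v ≠ σ.1 v} < 2 * m := by
      constructor
      · exact Nat.pos_of_ne_zero fun h => hτ' (sameCommunities_of_disagreement (.inl h))
      · exact lt_of_le_of_ne hle fun h => hτ' (sameCommunities_of_disagreement (.inr h))
    have h2 := card_sepPairs σ τ
    have h3 := card_sepPairs τ σ
    simp only [ne_comm (a := σ.1 _)] at h3
    simp only [hF]
    rw [if_pos h1]
    refine Real.exp_le_exp.2 (le_of_eq ?_)
    have e2 : (#(sepPairs σ.1 τ.1) : ℝ) = #{v | τ.1 v ≠ σ.1 v} *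
      (((2 * m : ℕ) : ℝ) - #{v | τ.1 v ≠ σ.1 v}) / 2 := by linarith
    have e3 : (#(sepPairs τ.1 σ.1) : ℝ) = #{v | τ.1 v ≠ σ.1 v} *
      (((2 * m : ℕ) : ℝ) - #{v | τ.1 v ≠ σ.1 v}) / 2 := by linarith
    rw [e2, e3]
    ring
  refine (Finset.sum_le_sum hterm).trans ?_
  rw [← ENNReal.ofReal_sum_of_nonneg fun _ _ => hF0 _]
  refine ENNReal.ofReal_le_ofReal ?_
  have hinj : Function.Injective fun τ : BalancedLabeling 2 m =>
      ({v | τ.1 v ≠ σ.1 v} : Finset (Fin (2 * m))) :=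
    (disagreement_injective σ.1).comp Subtype.val_injective
  calc ∑ τ ∈ bad, F #{v | τ.1 v ≠ σ.1 v}
      = ∑ D ∈ bad.map ⟨_, hinj⟩, F #D := by rw [Finset.sum_map]; rfl
    _ ≤ ∑ D ∈ (Finset.univ : Finset (Fin (2 * m))).powerset, F #D :=
        Finset.sum_le_sum_of_subset_of_nonneg (fun D _ => by simp) fun _ _ _ => hF0 _
    _ = _ := by
        rw [Finset.sum_powerset_apply_card]
        simp only [Finset.card_univ, Fintype.card_fin, nsmul_eq_mul, hF]

theorem coe_edgeProb {c : ℝ} (hc : 0 ≤ c) {n : ℕ} (h : c * Real.log n / n ≤ 1) :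
    (edgeProb c n : ℝ) = c * Real.log n / n := by
  have h0 : 0 ≤ c * Real.log n / n :=
    div_nonneg (mul_nonneg hc (Real.log_natCast_nonneg n)) (Nat.cast_nonneg n)
  rw [edgeProb, Set.projIcc_of_mem _ ⟨h0, h⟩]

theorem tendsto_mul_log_div (c : ℝ) :
    Tendsto (fun n : ℕ => c * Real.log n / n) atTop (𝓝 0) := by
  have h := (Real.isLittleO_log_id_atTop.tendsto_div_nhds_zero).comp
    (tendsto_natCast_atTop_atTop (R := ℝ))
  have := h.const_mul c
  simpa [Function.comp_def, mul_div_assoc] using this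

theorem eventually_coe_edgeProb {c : ℝ} (hc : 0 ≤ c) :
    ∀ᶠ n : ℕ in atTop, (edgeProb c n : ℝ) = c * Real.log n / n := by
  filter_upwards [(tendsto_mul_log_div c).eventually_lt_const zero_lt_one] with n hn
  exact coe_edgeProb hc hn.le

theorem tendsto_two_mul_atTop : Tendsto (fun m : ℕ => 2 * m) atTop atTop :=
  tendsto_id.const_mul_atTop' (by norm_num)

/-- Above the threshold the minimum bisection recovers the communities. -/
theorem exactRecoveryPossible_sensLaw {a b : ℝ} (hb : 0 ≤ b) (hab : b < a) (s : unitInterval)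
    (h : 2 < (s : ℝ) * (√a - √b) ^ 2) : ExactRecoveryPossible 2 (sensLaw 2 a b s) := by
  obtain ⟨z, hz, hz2⟩ := exists_tilt hb hab h
  set γ := (s : ℝ) * (a * (1 - z⁻¹) - b * (z - 1)) / 2 with hγ
  have hγ1 : 1 < γ := by linarith
  refine ⟨fun m G => PMF.pure (minBisection G).1, ?_⟩
  set ε : ℕ → ℝ := fun n => ∑ d ∈ Finset.range (n + 1), (n.choose d : ℝ) *
      if 0 < d ∧ d < n then Real.exp (-(d * (n - d) * (γ * Real.log n / n))) else 0 with hε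
  have hεlim : Tendsto (fun m : ℕ => 1 - ENNReal.ofReal (ε (2 * m))) atTop (𝓝 1) := by
    have h1 : Tendsto (fun m : ℕ => ENNReal.ofReal (ε (2 * m))) atTop (𝓝 0) := by
      have := (ENNReal.continuous_ofReal.tendsto 0).comp
        ((tendsto_sum_choose_mul_exp hγ1).comp tendsto_two_mul_atTop)
      rwa [ENNReal.ofReal_zero] at this
    simpa using ENNReal.Tendsto.sub tendsto_const_nhds h1 (.inl ENNReal.one_ne_top)
  refine tendsto_of_tendsto_of_tendsto_of_le_of_le' hεlim tendsto_const_nhds ?_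
    (.of_forall fun m => prob_le_one _ _)
  filter_upwards [tendsto_two_mul_atTop.eventually (eventually_coe_edgeProb (hb.trans hab.le)),
    tendsto_two_mul_atTop.eventually (eventually_coe_edgeProb hb)] with m hpa hpb
  rw [sensLaw_eq_sbm, PMF.bind_bind]
  refine le_prob_bind _ _ _ _ fun σ => ?_
  rw [PMF.bind_map]
  have hlaw : (sbm σ.1 (edgeProb a (2 * m) * s) (edgeProb b (2 * m) * s)).bind
      ((fun x : (Fin (2 * m) → Fin 2) × SimpleGraph (Fin (2 * m)) =>
        (PMF.pure (minBisection x.2).1).map fun τ => (x.1, τ)) ∘ fun H => (σ.1, H)) =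
      (sbm σ.1 (edgeProb a (2 * m) * s) (edgeProb b (2 * m) * s)).map
        fun H => (σ.1, (minBisection H).1) := by
    simp only [Function.comp_def, PMF.pure_map]
    rfl
  rw [hlaw, prob_map]
  refine le_trans ?_ (one_sub_prob_compl_le _ _)
  refine tsub_le_tsub_left ?_ 1
  refine (prob_not_sameCommunities_minBisection_le σ _ _ hz).trans (le_of_eq ?_)
  have hrate : (((edgeProb a (2 * m) * s : unitInterval) : ℝ) * (1 - z⁻¹) -
      ((edgeProb b (2 * m) * s : unitInterval) : ℝ) * (z - 1)) / 2 =
      γ * Real.log (2 * m : ℕ) / (2 * m : ℕ) := by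
    rw [Set.Icc.coe_mul, Set.Icc.coe_mul, hpa, hpb, hγ]
    ring
  rw [hrate]

/-! ### Two subsamples of one block model -/

section PairLaw

variable {n C : ℕ}

/-- The joint law of two independent subsamples of a stochastic block model. -/
noncomputable def pairLaw (σ : Fin n → Fin C) (p q s s' : unitInterval) :
    PMF (SimpleGraph (Fin n) × SimpleGraph (Fin n)) :=
  (sbm σ p q).bind fun G => (subsample s G).bind fun G₁ => (subsample s' G).map fun G₂ => (G₁, G₂)

/-- The common subgraph of the two subsamples is again a stochastic block model. -/
theorem pairLaw_map_inf (σ : Fin n → Fin C) (p q s s' : unitInterval) :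
    (pairLaw σ p q s s').map (fun x => x.1 ⊓ x.2) = sbm σ (p * (s * s')) (q * (s * s')) := by
  rw [← sbm_bind_subsample, pairLaw, PMF.map_bind]
  congr 1
  ext1 G
  obtain ⟨S, rfl⟩ := exists_eq_fromEdgeSet G
  rw [PMF.map_bind]
  simp only [PMF.map_comp, subsample_fromEdgeSet, PMF.bind_map, Function.comp_def]
  rw [← randomSubset_bind_inter, PMF.map_bind]
  simp only [PMF.map_comp, Function.comp_def]
  congr 1
  ext1 T
  congr 1
  ext1 U
  rw [← SimpleGraph.fromEdgeSet_inter, ← Finset.coe_inter, ← Finset.inter_inter_distrib_left]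

open Classical in
theorem subsample_apply (s : unitInterval) (G H : SimpleGraph (Fin n)) :
    subsample s G H = ∏ e, if e.IsDiag then 1 else
      if e ∈ G.edgeSet then
        (if e ∈ H.edgeSet then ENNReal.ofReal s else ENNReal.ofReal (1 - (s : ℝ)))
      else if e ∈ H.edgeSet then 0 else 1 := by
  have key := sum_randomSubset_mul_prod (fun _ : Sym2 (Fin n) => s)
    (fun e => if e.IsDiag then 1 else
      if e ∈ G.edgeSet then (if e ∈ H.edgeSet then 1 else 0) else if e ∈ H.edgeSet then 0 else 1)
    (fun e => if e.IsDiag then 1 else if e ∈ H.edgeSet then 0 else 1)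
  rw [subsample_eq_map, PMF.map_apply, tsum_fintype]
  have hs : ENNReal.ofReal s + ENNReal.ofReal (1 - (s : ℝ)) = 1 := by
    rw [← ENNReal.ofReal_add s.2.1 (sub_nonneg.2 s.2.2)]; simp
  refine Eq.trans (Finset.sum_congr rfl fun T _ => ?_)
    (key.trans (Finset.prod_congr rfl fun e _ => ?_))
  · have h1 : (∏ e, if e ∈ T then
        ((if e.IsDiag then 1 else if e ∈ G.edgeSet then (if e ∈ H.edgeSet then 1 else 0)
          else if e ∈ H.edgeSet then 0 else 1) : ENNReal)
        else if e.IsDiag then 1 else if e ∈ H.edgeSet then 0 else 1) =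
        ∏ e, if (e.IsDiag ∨ (e ∈ H.edgeSet ↔ e ∈ G.edgeSet ∧ e ∈ T)) then 1 else 0 :=
      Finset.prod_congr rfl fun e _ => by split_ifs <;> tauto
    have h2 : H = SimpleGraph.fromEdgeSet (G.edgeSet ∩ (T : Set (Sym2 (Fin n)))) ↔
        ∀ e : Sym2 (Fin n), (e.IsDiag ∨ (e ∈ H.edgeSet ↔ e ∈ G.edgeSet ∧ e ∈ T)) := by
      rw [← SimpleGraph.edgeSet_inj, Set.ext_iff]
      refine forall_congr' fun e => ?_
      rw [SimpleGraph.edgeSet_fromEdgeSet]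
      simp only [Set.mem_sdiff, Set.mem_inter_iff, Finset.mem_coe, Sym2.mem_diagSet]
      have := H.not_isDiag_of_mem_edgeSet (e := e)
      tauto
    rw [h1, Fintype.prod_boole]
    simp only [h2]
    split_ifs <;> simp
  · split_ifs <;> simp [hs]

/-- The probability that a pair whose edge probability is `p` has the status `α` in one subsample
and the status `β` in the other one. -/
noncomputable def pairWeight (p s s' : unitInterval) (α β : Prop) [Decidable α] [Decidable β] :
    ENNReal :=
  ENNReal.ofReal p * ((if α then ENNReal.ofReal s else ENNReal.ofReal (1 - (s : ℝ))) *
    (if β then ENNReal.ofReal s' else ENNReal.ofReal (1 - (s' : ℝ)))) +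
  ENNReal.ofReal (1 - (p : ℝ)) * if α ∨ β then 0 else 1

open Classical in
theorem pairLaw_apply (σ : Fin n → Fin C) (p q s s' : unitInterval) (G₁ G₂ : SimpleGraph (Fin n)) :
    pairLaw σ p q s s' (G₁, G₂) = ∏ e : Sym2 (Fin n), if e.IsDiag then 1 else
      pairWeight (if (e.map σ).IsDiag then p else q) s s' (e ∈ G₁.edgeSet) (e ∈ G₂.edgeSet) := by
  have hG : ∀ G : SimpleGraph (Fin n), ((subsample s G).bind fun G₁ =>
      (subsample s' G).map fun G₂ => (G₁, G₂)) (G₁, G₂) =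
      subsample s G G₁ * subsample s' G G₂ := by
    intro G
    rw [PMF.bind_apply, tsum_eq_single G₁]
    · rw [PMF.map_apply, tsum_eq_single G₂]
      · simp
      · intro H hH
        exact if_neg fun h => hH (Prod.ext_iff.1 h).2.symm
    · intro H hH
      rw [PMF.map_apply, ENNReal.tsum_eq_zero.2, mul_zero]
      exact fun K => if_neg fun h => hH (Prod.ext_iff.1 h).1.symm
  rw [pairLaw, sbm_eq_map, PMF.bind_map, PMF.bind_apply, tsum_fintype]
  simp only [Function.comp_apply, hG, subsample_apply, ← Finset.prod_mul_distrib]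
  have key := sum_randomSubset_mul_prod
    (fun e : Sym2 (Fin n) => if (e.map σ).IsDiag then p else q)
    (fun e => if e.IsDiag then 1 else
      (if e ∈ G₁.edgeSet then ENNReal.ofReal s else ENNReal.ofReal (1 - (s : ℝ))) *
      (if e ∈ G₂.edgeSet then ENNReal.ofReal s' else ENNReal.ofReal (1 - (s' : ℝ))))
    (fun e => if e.IsDiag then 1 else if e ∈ G₁.edgeSet ∨ e ∈ G₂.edgeSet then 0 else 1)
  refine Eq.trans (Finset.sum_congr rfl fun T _ => ?_)
    (key.trans (Finset.prod_congr rfl fun e _ => ?_))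
  · congr 1
    refine Finset.prod_congr rfl fun e _ => ?_
    simp only [SimpleGraph.edgeSet_fromEdgeSet, Set.mem_sdiff, Finset.mem_coe, Sym2.mem_diagSet]
    by_cases he : e.IsDiag
    · simp [he]
    · by_cases hT : e ∈ T
      · simp [he, hT]
      · by_cases h1 : e ∈ G₁.edgeSet <;> by_cases h2 : e ∈ G₂.edgeSet <;> simp [he, hT, h1, h2]
  · by_cases he : e.IsDiag
    · have := (if (e.map σ).IsDiag then p else q).2
      simp only [he, if_true, mul_one]
      rw [← ENNReal.ofReal_add this.1 (sub_nonneg.2 this.2)]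
      simp
    · simp only [he, if_false, pairWeight]

/-- Exchanging the second statuses of two pairs, neither of which is an edge in both graphs, does
not decrease the probability: two coincidences of an edge with a non-edge may turn into a
coincidence of two edges and one of two non-edges, which is more likely. -/
theorem pairWeight_mul_le (p s s' : unitInterval) (α β α' β' : Prop) [Decidable α] [Decidable β]
    [Decidable α'] [Decidable β'] (h : ¬ (α ∧ β)) (h' : ¬ (α' ∧ β')) :
    pairWeight p s s' α β * pairWeight p s s' α' β' ≤
      pairWeight p s s' α β' * pairWeight p s s' α' β := by
  have key : ∀ P S U S' U' R : ENNReal,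
      P * (S * U') * (P * (U * S')) ≤ P * (S * S') * (P * (U * U') + R) := by
    intro P S U S' U' R
    calc P * (S * U') * (P * (U * S')) = P * (S * S') * (P * (U * U')) := by ring
      _ ≤ _ := by gcongr; exact le_self_add
  by_cases hα : α <;> by_cases hβ : β <;> by_cases hα' : α' <;> by_cases hβ' : β' <;>
    simp only [hα, hβ, hα', hβ', and_self, not_true, and_true, and_false, not_false_eq_true]
      at h h' <;>
    simp only [pairWeight, hα, hβ, hα', hβ', if_true, if_false, or_self, or_true, or_false,
      mul_zero, mul_one, add_zero, le_refl]
  · exact key _ _ _ _ _ _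
  · rw [mul_comm (_ + _)]; exact (mul_comm _ _).le.trans (key _ _ _ _ _ _)
  · exact (mul_comm _ _).le
  · exact (mul_comm _ _).le

/-- If `u` and `v` have the same label and no neighbours in the common subgraph, then exchanging
them in the second graph does not decrease the likelihood. -/
theorem pairLaw_le_swap (σ : Fin n → Fin C) (p q s s' : unitInterval)
    (G₁ G₂ : SimpleGraph (Fin n)) {u v : Fin n} (huv : σ u = σ v)
    (hu : ∀ w, ¬ (G₁ ⊓ G₂).Adj u w) (hv : ∀ w, ¬ (G₁ ⊓ G₂).Adj v w) :
    pairLaw σ p q s s' (G₁, G₂) ≤ pairLaw σ p q s s' (G₁, G₂.map (Equiv.swap u v)) := by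
  classical
  set τ := Equiv.swap u v with hτ
  have hττ : ∀ e : Sym2 (Fin n), (e.map τ).map τ = e := fun e => by
    induction e with | _ x y => simp [hτ]
  have hmem : ∀ e : Sym2 (Fin n), e ∈ (G₂.map τ).edgeSet ↔ e.map τ ∈ G₂.edgeSet := by
    intro e
    induction e with | _ x y => simp [map_perm_adj, hτ]
  have hdiag : ∀ e : Sym2 (Fin n), (e.map τ).IsDiag ↔ e.IsDiag := by
    intro e
    induction e with | _ x y => simp
  have hσ : ∀ e : Sym2 (Fin n), (e.map τ).map σ = e.map σ := by
    intro e
    rw [Sym2.map_map]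
    congr 1
    ext1 x
    simp only [Function.comp_apply, hτ, Equiv.swap_apply_def]
    split_ifs with h1 h2
    · rw [h1, huv]
    · rw [h2, huv]
    · rfl
  have hiso : ∀ x y, (x = u ∨ x = v) → ¬ (G₁.Adj x y ∧ G₂.Adj x y) := by
    rintro x y (rfl | rfl)
    · exact hu y
    · exact hv y
  have hcase : ∀ e : Sym2 (Fin n), e.map τ = e ∨
      (¬ (e ∈ G₁.edgeSet ∧ e ∈ G₂.edgeSet) ∧
        ¬ (e.map τ ∈ G₁.edgeSet ∧ e.map τ ∈ G₂.edgeSet)) := by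
    have main : ∀ x y, (x = u ∨ x = v) → ¬ (s(x, y) ∈ G₁.edgeSet ∧ s(x, y) ∈ G₂.edgeSet) ∧
        ¬ ((s(x, y)).map τ ∈ G₁.edgeSet ∧ (s(x, y)).map τ ∈ G₂.edgeSet) := by
      intro x y hx
      refine ⟨hiso x y hx, hiso (τ x) (τ y) ?_⟩
      rcases hx with rfl | rfl
      · right; simp [hτ]
      · left; simp [hτ]
    intro e
    induction e with | _ x y =>
    by_cases hx : x = u ∨ x = v
    · exact .inr (main x y hx)
    by_cases hy : y = u ∨ y = v
    · rw [Sym2.eq_swap]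
      exact .inr (main y x hy)
    · push Not at hx hy
      left
      simp [hτ, Equiv.swap_apply_of_ne_of_ne hx.1 hx.2, Equiv.swap_apply_of_ne_of_ne hy.1 hy.2]
  rw [pairLaw_apply, pairLaw_apply]
  set W : Sym2 (Fin n) → ENNReal := fun e => if e.IsDiag then 1 else
      pairWeight (if (e.map σ).IsDiag then p else q) s s' (e ∈ G₁.edgeSet) (e ∈ G₂.edgeSet) with hW
  set W' : Sym2 (Fin n) → ENNReal := fun e => if e.IsDiag then 1 else
      pairWeight (if (e.map σ).IsDiag then p else q) s s' (e ∈ G₁.edgeSet)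
        (e ∈ (G₂.map τ).edgeSet) with hW'
  have hreindex : ∀ F : Sym2 (Fin n) → ENNReal, ∏ e : Sym2 (Fin n), F (e.map τ) = ∏ e, F e :=
    fun F => Equiv.prod_comp (pairPerm τ) F
  -- the two products are compared after squaring, where every pair is matched with its image
  have hsq : (∏ e, W e) ^ 2 ≤ (∏ e, W' e) ^ 2 := by
    have h2 : ∀ F : Sym2 (Fin n) → ENNReal,
        (∏ e, F e) ^ 2 = ∏ e : Sym2 (Fin n), F e * F (e.map τ) := fun F => by
      rw [Finset.prod_mul_distrib, hreindex F, sq]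
    rw [h2 W, h2 W']
    refine Finset.prod_le_prod (fun _ _ => zero_le) fun e _ => ?_
    rcases hcase e with he | ⟨h, h'⟩
    · simp only [hW, hW', hmem, he, le_refl]
    · by_cases hd : e.IsDiag
      · simp only [hW, hW', hdiag, hd, if_true, le_refl]
      · simp only [hW, hW', hdiag, hd, if_false, hσ, hmem, hττ]
        exact pairWeight_mul_le _ _ _ _ _ _ _ h h'
  have hle := (ENNReal.pow_le_pow_left_iff two_ne_zero).1 hsq
  simp only [hW'] at hle
  convert hle

end PairLaw

/-! ### The success probability of an attack -/

section Attack

variable {n C : ℕ}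

/-- What the adversary sees if `π` anonymizes the second of the two subsamples `x`. -/
def viewOf (σ : Fin n → Fin C) (π : Equiv.Perm (Fin n))
    (x : SimpleGraph (Fin n) × SimpleGraph (Fin n)) : Observation n C where
  aux := x.1
  released := x.2.map π
  auxLabel := σ
  releasedLabel := fun v => σ (π.symm v)

theorem map_perm_map_perm (π τ : Equiv.Perm (Fin n)) (G : SimpleGraph (Fin n)) :
    (G.map τ).map π = G.map (π * τ) := by
  ext u v
  simp only [map_perm_adj]
  rfl

/-- A permutation of the second graph which respects the labels is absorbed by the anonymization. -/
theorem viewOf_map_perm (σ : Fin n → Fin C) (π τ : Equiv.Perm (Fin n)) (hτ : ∀ v, σ (τ v) = σ v)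
    (x : SimpleGraph (Fin n) × SimpleGraph (Fin n)) :
    viewOf σ π (x.1, x.2.map τ) = viewOf σ (π * τ) x := by
  have h : ∀ v, σ ((π * τ).symm v) = σ (π.symm v) := fun v => by
    rw [← hτ]
    exact congrArg σ (τ.apply_symm_apply (π.symm v))
  simp only [viewOf, h, map_perm_map_perm]

/-- The Bayesian bound. If every pair of graphs in `good` admits `M` label-preserving permutations
of its second graph which do not decrease the likelihood, then the true anonymization is at most
one of `M` equally plausible candidates. -/
theorem sum_mul_success_le (J : PMF (SimpleGraph (Fin n) × SimpleGraph (Fin n)))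
    (σ : Fin n → Fin C) (A : Observation n C → PMF (Fin n → Fin n))
    (good : Set (SimpleGraph (Fin n) × SimpleGraph (Fin n))) (M : ℕ) (hM : M ≠ 0)
    (hgood : ∀ x ∈ good, ∃ S : Finset (Equiv.Perm (Fin n)), M ≤ #S ∧
      ∀ τ ∈ S, (∀ v, σ (τ v) = σ v) ∧ J x ≤ J (x.1, x.2.map τ)) :
    ∑ x, J x * ∑ π : Equiv.Perm (Fin n),
      (Fintype.card (Equiv.Perm (Fin n)) : ENNReal)⁻¹ * A (viewOf σ π x) π ≤
      prob J goodᶜ + (M : ENNReal)⁻¹ := by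
  classical
  set c : ENNReal := (Fintype.card (Equiv.Perm (Fin n)) : ENNReal)⁻¹ with hc
  have hc1 : ∑ _π : Equiv.Perm (Fin n), c = 1 := by
    rw [Finset.sum_const, Finset.card_univ, nsmul_eq_mul, hc]
    exact ENNReal.mul_inv_cancel (by simp [Fintype.card_ne_zero]) (ENNReal.natCast_ne_top _)
  have hJ : ∑ x, J x = 1 := by
    have := J.tsum_coe
    rwa [tsum_fintype] at this
  have hM0 : (M : ENNReal) ≠ 0 := by exact_mod_cast hM
  set u : SimpleGraph (Fin n) × SimpleGraph (Fin n) → ENNReal :=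
    fun x => ∑ π : Equiv.Perm (Fin n), c * A (viewOf σ π x) π with hu
  have hu1 : ∀ x, u x ≤ 1 := fun x => by
    rw [← hc1]
    exact Finset.sum_le_sum fun π _ => mul_le_of_le_one_right zero_le ((A _).coe_le_one _)
  -- the likelihood that the attack outputs `π * τ` where the truth is `π`
  set V : Equiv.Perm (Fin n) → SimpleGraph (Fin n) × SimpleGraph (Fin n) → ENNReal :=
    fun τ y => ∑ π : Equiv.Perm (Fin n), c * (J y * A (viewOf σ π y) ⇑(π * τ)) with hV
  have hVsum : ∑ τ, ∑ y, V τ y ≤ 1 := by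
    rw [Finset.sum_comm, ← hJ]
    refine Finset.sum_le_sum fun y _ => ?_
    simp only [hV]
    rw [Finset.sum_comm]
    calc ∑ π : Equiv.Perm (Fin n), ∑ τ : Equiv.Perm (Fin n),
          c * (J y * A (viewOf σ π y) ⇑(π * τ))
        ≤ ∑ π : Equiv.Perm (Fin n), c * J y := by
          refine Finset.sum_le_sum fun π _ => ?_
          rw [← Finset.mul_sum, ← Finset.mul_sum]
          gcongr
          refine mul_le_of_le_one_right zero_le ?_
          have hinj : Function.Injective fun τ : Equiv.Perm (Fin n) => ⇑(π * τ) := fun τ τ' h =>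
            mul_left_cancel (DFunLike.coe_injective h)
          calc ∑ τ : Equiv.Perm (Fin n), A (viewOf σ π y) ⇑(π * τ)
              = ∑ φ ∈ Finset.univ.map ⟨_, hinj⟩, A (viewOf σ π y) φ := by
                rw [Finset.sum_map]; rfl
            _ ≤ ∑' φ, A (viewOf σ π y) φ := ENNReal.sum_le_tsum _
            _ = 1 := PMF.tsum_coe _
      _ = J y := by rw [← Finset.sum_mul, hc1, one_mul]
  have hx : ∀ x, J x * u x ≤ goodᶜ.indicator J x +
      (M : ENNReal)⁻¹ * ∑ τ : Equiv.Perm (Fin n), V τ (x.1, x.2.map τ) := by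
    intro x
    by_cases hxg : x ∈ good
    · obtain ⟨S, hS, hSτ⟩ := hgood x hxg
      refine le_trans ?_ le_add_self
      rw [mul_comm (M : ENNReal)⁻¹, ← div_eq_mul_inv, ENNReal.le_div_iff_mul_le (.inl hM0)
        (.inl (ENNReal.natCast_ne_top M))]
      calc J x * u x * M ≤ J x * u x * #S := by gcongr
        _ = ∑ τ ∈ S, J x * u x := by rw [Finset.sum_const, nsmul_eq_mul, mul_comm]
        _ ≤ ∑ τ ∈ S, V τ (x.1, x.2.map τ) := by
          refine Finset.sum_le_sum fun τ hτ => ?_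
          obtain ⟨h1, h2⟩ := hSτ τ hτ
          simp only [hV, hu]
          rw [← Equiv.sum_comp (Equiv.mulRight τ), Finset.mul_sum]
          refine Finset.sum_le_sum fun π _ => ?_
          simp only [Equiv.coe_mulRight]
          rw [viewOf_map_perm σ π τ h1 x, mul_left_comm]
          gcongr
        _ ≤ ∑ τ, V τ (x.1, x.2.map τ) :=
          Finset.sum_le_sum_of_subset (Finset.subset_univ S)
    · rw [Set.indicator_of_mem (by exact hxg)]
      exact (mul_le_of_le_one_right zero_le (hu1 x)).trans le_self_add
  have hre : ∀ τ : Equiv.Perm (Fin n), ∑ x : SimpleGraph (Fin n) × SimpleGraph (Fin n),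
      V τ (x.1, x.2.map τ) = ∑ y, V τ y := by
    intro τ
    have hinj : Function.Injective
        fun x : SimpleGraph (Fin n) × SimpleGraph (Fin n) => (x.1, x.2.map τ) := by
      rintro ⟨a, b⟩ ⟨a', b'⟩ h
      have h1 := congrArg Prod.fst h
      have h2 := congrArg (fun y => y.2.map (τ⁻¹ : Equiv.Perm (Fin n))) h
      simp only [map_perm_map_perm, inv_mul_cancel] at h1 h2
      have hone : ∀ G : SimpleGraph (Fin n), G.map (1 : Equiv.Perm (Fin n)) = G := fun G => by
        ext u v; rw [map_perm_adj]; rfl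
      rw [hone, hone] at h2
      rw [h1, h2]
    exact Fintype.sum_bijective _ (Finite.injective_iff_bijective.1 hinj) _ _ fun x => rfl
  calc ∑ x, J x * u x
      ≤ ∑ x, (goodᶜ.indicator J x +
        (M : ENNReal)⁻¹ * ∑ τ : Equiv.Perm (Fin n), V τ (x.1, x.2.map τ)) :=
        Finset.sum_le_sum fun x _ => hx x
    _ = prob J goodᶜ + (M : ENNReal)⁻¹ * ∑ τ, ∑ y, V τ y := by
        rw [Finset.sum_add_distrib, ← Finset.mul_sum, Finset.sum_comm, prob,
          PMF.toOuterMeasure_apply_fintype]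
        simp only [hre]
    _ ≤ prob J goodᶜ + (M : ENNReal)⁻¹ := by
        gcongr
        exact mul_le_of_le_one_right zero_le hVsum

open Classical in
/-- The isolated vertices of `K` with label `0`. -/
noncomputable def isolatedZero (σ : Fin n → Fin 2) (K : SimpleGraph (Fin n)) : Finset (Fin n) :=
  {v | σ v = 0 ∧ ∀ w, ¬ K.Adj v w}

/-- For given labels, an attack succeeds at most with the probability of fewer than `M` isolated
vertices of label `0` in the common subgraph, plus `1 / M`. -/
theorem sum_pairLaw_mul_success_le (σ : Fin n → Fin 2) (p q s s' : unitInterval)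
    (A : Observation n 2 → PMF (Fin n → Fin n)) (M : ℕ) (hM : M ≠ 0) :
    ∑ x, pairLaw σ p q s s' x * ∑ π : Equiv.Perm (Fin n),
      (Fintype.card (Equiv.Perm (Fin n)) : ENNReal)⁻¹ * A (viewOf σ π x) π ≤
      prob (sbm σ (p * (s * s')) (q * (s * s'))) {K | #(isolatedZero σ K) < M} +
        (M : ENNReal)⁻¹ := by
  have h := sum_mul_success_le (pairLaw σ p q s s') σ A
    {x | M ≤ #(isolatedZero σ (x.1 ⊓ x.2))} M hM ?_
  · refine h.trans (le_of_eq ?_)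
    rw [← pairLaw_map_inf, prob_map]
    congr 2
    ext x
    simp
  · rintro ⟨G₁, G₂⟩ hx
    simp only [Set.mem_ofPred_eq] at hx
    obtain ⟨u, hu⟩ := Finset.card_pos.1 ((Nat.pos_of_ne_zero hM).trans_le hx)
    have hinj : Function.Injective fun v : Fin n => Equiv.swap u v := fun v v' h => by
      have := congrArg (fun τ : Equiv.Perm (Fin n) => τ u) h
      simpa using this
    refine ⟨(isolatedZero σ (G₁ ⊓ G₂)).map ⟨_, hinj⟩, by rwa [Finset.card_map], ?_⟩
    intro τ hτ
    obtain ⟨v, hv, rfl⟩ := Finset.mem_map.1 hτ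
    simp only [isolatedZero, Finset.mem_filter, Finset.mem_univ, true_and] at hu hv
    have huv : σ u = σ v := hu.1.trans hv.1.symm
    refine ⟨fun w => ?_, pairLaw_le_swap σ p q s s' G₁ G₂ huv hu.2 hv.2⟩
    simp only [Function.Embedding.coeFn_mk, Equiv.swap_apply_def]
    split_ifs with h1 h2
    · rw [h1, huv]
    · rw [h2, huv]
    · rfl

end Attack

/-- The joint law of the anonymization and the output of an attack. The two subsampling steps of the
sensitive graph merge into one, which precedes the anonymization. -/
theorem model_bind_attack (C : ℕ) (a b : ℝ) (s₁ s₂ t : unitInterval) (m : ℕ)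
    (A : Observation (C * m) C → PMF (Fin (C * m) → Fin (C * m))) :
    ((model C a b s₁ s₂ t m).bind fun x => (A x.view).map fun φ => (x.anon, φ)) =
      (PMF.uniformOfFintype (BalancedLabeling C m)).bind fun σ =>
      (pairLaw σ.1 (edgeProb a (C * m)) (edgeProb b (C * m)) s₁ (s₂ * t)).bind fun x =>
      (PMF.uniformOfFintype (Equiv.Perm (Fin (C * m)))).bind fun π =>
      (A (viewOf σ.1 π x)).map fun φ => (π, φ) := by
  simp only [model, pairLaw, PMF.bind_bind, PMF.bind_map]
  congr 1
  ext1 σ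
  congr 1
  ext1 G
  congr 1
  ext1 G₁
  have h1 : ∀ (F : Equiv.Perm (Fin (C * m)) → SimpleGraph (Fin (C * m)) →
        PMF (Equiv.Perm (Fin (C * m)) × (Fin (C * m) → Fin (C * m)))),
      ((subsample s₂ G).bind fun G₂ => (PMF.uniformOfFintype (Equiv.Perm (Fin (C * m)))).bind
        fun π => (subsample t (G₂.map π)).bind fun H => F π H) =
      (subsample (s₂ * t) G).bind fun G₂ =>
        (PMF.uniformOfFintype (Equiv.Perm (Fin (C * m)))).bind fun π => F π (G₂.map π) := by
    intro F
    rw [← subsample_bind_subsample, PMF.bind_bind]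
    congr 1
    ext1 G₂
    rw [PMF.bind_comm (subsample t G₂)]
    simp only [subsample_map_perm, PMF.bind_map, Function.comp_def]
  exact h1 fun π H => (A ⟨G₁, H, σ.1, fun v => σ.1 (π.symm v)⟩).map fun φ => (π, φ)

theorem prob_attack_le (a b : ℝ) (s₁ s₂ t : unitInterval) (m : ℕ)
    (A : Observation (2 * m) 2 → PMF (Fin (2 * m) → Fin (2 * m))) (M : ℕ) (hM : M ≠ 0)
    (c : ENNReal) (hc : ∀ σ : BalancedLabeling 2 m,
      prob (sbm σ.1 (edgeProb a (2 * m) * (s₁ * (s₂ * t))) (edgeProb b (2 * m) * (s₁ * (s₂ * t))))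
        {K | #(isolatedZero σ.1 K) < M} ≤ c) :
    prob ((model 2 a b s₁ s₂ t m).bind fun x => (A x.view).map fun φ => (x, φ))
      {y | y.2 = y.1.anon} ≤ c + (M : ENNReal)⁻¹ := by
  have h1 : prob ((model 2 a b s₁ s₂ t m).bind fun x => (A x.view).map fun φ => (x, φ))
      {y | y.2 = y.1.anon} =
      prob ((model 2 a b s₁ s₂ t m).bind fun x => (A x.view).map fun φ => (x.anon, φ))
        {y | y.2 = y.1} := by
    have : ((model 2 a b s₁ s₂ t m).bind fun x => (A x.view).map fun φ => (x.anon, φ)) =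
        ((model 2 a b s₁ s₂ t m).bind fun x => (A x.view).map fun φ => (x, φ)).map
          fun y => (y.1.anon, y.2) := by
      simp only [PMF.map_bind, PMF.map_comp, Function.comp_def]
    rw [this, prob_map]
    rfl
  rw [h1, model_bind_attack]
  refine prob_bind_le _ _ _ _ fun σ => ?_
  refine le_trans (le_of_eq ?_) ((sum_pairLaw_mul_success_le σ.1 _ _ _ _ A M hM).trans
    (add_le_add_left (hc σ) _))
  rw [prob_bind, tsum_fintype]
  refine Finset.sum_congr rfl fun x _ => ?_
  rw [prob_bind, tsum_fintype]
  congr 1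
  refine Finset.sum_congr rfl fun π _ => ?_
  rw [PMF.uniformOfFintype_apply, prob_map]
  congr 1
  have hset : (fun φ : Fin (2 * m) → Fin (2 * m) => (π, φ)) ⁻¹' {y | y.2 = y.1} = {⇑π} := by
    ext φ; simp
  rw [hset]
  exact PMF.toOuterMeasure_apply_singleton _ _

/-! ### Counting isolated vertices -/

/-- Chebyshev's inequality for a sum of `0`-`1` variables which are nearly uncorrelated. -/
theorem prob_sum_le_half_le {Ω ι : Type*} [Fintype Ω] (μ : PMF Ω) (I : Finset ι)
    (g : ι → Ω → ℝ) (hg : ∀ i ω, g i ω * g i ω = g i ω) (α : ι → ℝ) {δ : ℝ} (hδ : 0 ≤ δ)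
    (h1 : ∀ i ∈ I, ∑ ω, (μ ω).toReal * g i ω = α i)
    (h2 : ∀ i ∈ I, ∀ j ∈ I, i ≠ j →
      ∑ ω, (μ ω).toReal * (g i ω * g j ω) ≤ α i * α j * (1 + δ))
    (hα : 0 < ∑ i ∈ I, α i) :
    prob μ {ω | ∑ i ∈ I, g i ω ≤ (∑ i ∈ I, α i) / 2} ≤
      ENNReal.ofReal (4 * ((∑ i ∈ I, α i)⁻¹ + δ)) := by
  classical
  set a := ∑ i ∈ I, α i with ha
  have hsum : ∑ ω, (μ ω).toReal = 1 := by
    rw [← ENNReal.toReal_sum fun ω _ => μ.apply_ne_top ω]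
    have := μ.tsum_coe
    rw [tsum_fintype] at this
    rw [this, ENNReal.toReal_one]
  have hX : ∑ ω, (μ ω).toReal * ∑ i ∈ I, g i ω = a := by
    simp only [Finset.mul_sum]
    rw [Finset.sum_comm, ha]
    exact Finset.sum_congr rfl h1
  have hα0 : ∀ i ∈ I, 0 ≤ α i := fun i hi => by
    rw [← h1 i hi]
    exact Finset.sum_nonneg fun ω _ => mul_nonneg ENNReal.toReal_nonneg (by
      rw [← hg]; exact mul_self_nonneg _)
  have hX2 : ∑ ω, (μ ω).toReal * (∑ i ∈ I, g i ω) ^ 2 ≤ a + a ^ 2 * (1 + δ) := by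
    have e1 : ∑ ω, (μ ω).toReal * (∑ i ∈ I, g i ω) ^ 2 =
        ∑ i ∈ I, ∑ j ∈ I, ∑ ω, (μ ω).toReal * (g i ω * g j ω) := by
      simp only [sq, Finset.sum_mul_sum]
      simp only [Finset.mul_sum]
      rw [Finset.sum_comm]
      exact Finset.sum_congr rfl fun i _ => Finset.sum_comm
    have e2 : a + a ^ 2 * (1 + δ) =
        ∑ i ∈ I, ∑ j ∈ I, ((if i = j then α i else 0) + α i * α j * (1 + δ)) := by
      simp only [Finset.sum_add_distrib, Finset.sum_ite_eq, ← Finset.sum_mul, sq, ha,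
        Finset.sum_mul_sum]
      congr 1
      exact Finset.sum_congr rfl fun i hi => by simp [hi]
    rw [e1, e2]
    refine Finset.sum_le_sum fun i hi => Finset.sum_le_sum fun j hj => ?_
    by_cases hij : i = j
    · subst hij
      simp only [hg, if_true]
      rw [h1 i hi]
      have := mul_nonneg (mul_nonneg (hα0 i hi) (hα0 i hi)) (by linarith : 0 ≤ 1 + δ)
      linarith
    · rw [if_neg hij, zero_add]
      exact h2 i hi j hj hij
  refine (prob_le_ofReal_sum μ _ (fun ω => 4 / a ^ 2 * (a - ∑ i ∈ I, g i ω) ^ 2)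
    (fun ω => by positivity) fun ω hω => ?_).trans (ENNReal.ofReal_le_ofReal ?_)
  · have hω' : ∑ i ∈ I, g i ω ≤ a / 2 := hω
    rw [div_mul_eq_mul_div, one_le_div (by positivity)]
    nlinarith
  · have e : ∑ ω, (μ ω).toReal * (4 / a ^ 2 * (a - ∑ i ∈ I, g i ω) ^ 2) =
        4 / a ^ 2 * (a ^ 2 * ∑ ω, (μ ω).toReal -
          2 * a * (∑ ω, (μ ω).toReal * ∑ i ∈ I, g i ω) +
          ∑ ω, (μ ω).toReal * (∑ i ∈ I, g i ω) ^ 2) := by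
      rw [Finset.mul_sum, Finset.mul_sum, ← Finset.sum_sub_distrib, ← Finset.sum_add_distrib,
        Finset.mul_sum]
      exact Finset.sum_congr rfl fun ω _ => by ring
    rw [e, hsum, hX]
    calc 4 / a ^ 2 * (a ^ 2 * 1 - 2 * a * a + ∑ ω, (μ ω).toReal * (∑ i ∈ I, g i ω) ^ 2)
        ≤ 4 / a ^ 2 * (a ^ 2 * 1 - 2 * a * a + (a + a ^ 2 * (1 + δ))) := by gcongr
      _ = 4 * (a⁻¹ + δ) := by field_simp; ring

theorem sum_toReal_randomSubset_disjoint {α : Type*} [Fintype α] [DecidableEq α]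
    (f : α → unitInterval) (S : Finset α) :
    ∑ T, (randomSubset f T).toReal * (if Disjoint T S then 1 else 0) =
      ∏ e ∈ S, (1 - (f e : ℝ)) := by
  have key := sum_toReal_randomSubset_mul_prod f (fun e => if e ∈ S then 0 else 1) fun _ => 1
  refine Eq.trans (Finset.sum_congr rfl fun T _ => ?_) (key.trans ?_)
  · congr 1
    rw [← Finset.prod_filter, Finset.prod_ite]
    by_cases h : Disjoint T S
    · have : ({e ∈ ({e | e ∈ T} : Finset α) | e ∈ S} : Finset α) = ∅ := by
        ext e; simpa using fun he => Finset.disjoint_left.1 h he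
      rw [this]; simp [h]
    · obtain ⟨e, he, he'⟩ := Finset.not_disjoint_iff.1 h
      rw [if_neg h, Finset.prod_eq_zero (i := e) (by simp [he, he']) rfl, zero_mul]
  · rw [← Finset.prod_subset (Finset.subset_univ S) fun e _ he => by simp [he]]
    exact Finset.prod_congr rfl fun e he => by simp [he]

section Isolated

variable {n : ℕ}

/-- The pairs of distinct vertices which contain `v`. -/
def incidentPairs (v : Fin n) : Finset (Sym2 (Fin n)) :=
  (Finset.univ.erase v).image fun w => s(v, w)

theorem mk_mem_incidentPairs {u v w : Fin n} :
    s(u, w) ∈ incidentPairs v ↔ u ≠ w ∧ (u = v ∨ w = v) := by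
  simp only [incidentPairs, Finset.mem_image, Finset.mem_erase, Finset.mem_univ, and_true,
    Sym2.eq_iff]
  constructor
  · rintro ⟨x, hx, ⟨rfl, rfl⟩ | ⟨rfl, rfl⟩⟩
    · exact ⟨hx.symm, .inl rfl⟩
    · exact ⟨hx, .inr rfl⟩
  · rintro ⟨h, rfl | rfl⟩
    · exact ⟨w, h.symm, .inl ⟨rfl, rfl⟩⟩
    · exact ⟨u, h, .inr ⟨rfl, rfl⟩⟩

theorem isolated_fromEdgeSet_iff (T : Finset (Sym2 (Fin n))) (v : Fin n) :
    (∀ w, ¬ (SimpleGraph.fromEdgeSet (T : Set (Sym2 (Fin n)))).Adj v w) ↔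
      Disjoint T (incidentPairs v) := by
  simp only [SimpleGraph.fromEdgeSet_adj, Finset.mem_coe]
  rw [Finset.disjoint_right]
  simp only [incidentPairs, Finset.forall_mem_image, Finset.mem_erase, Finset.mem_univ, and_true]
  exact forall_congr' fun w => ⟨fun h hw h' => h ⟨h', hw.symm⟩, fun h h' => h h'.2.symm h'.1⟩

theorem incidentPairs_inter_incidentPairs {u v : Fin n} (h : u ≠ v) :
    incidentPairs u ∩ incidentPairs v = {s(u, v)} := by
  ext e
  induction e with | _ x y =>
  simp only [Finset.mem_inter, mk_mem_incidentPairs, Finset.mem_singleton, Sym2.eq_iff]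
  grind

theorem prod_incidentPairs (v : Fin n) (F : Sym2 (Fin n) → ℝ) :
    ∏ e ∈ incidentPairs v, F e = ∏ w ∈ Finset.univ.erase v, F s(v, w) := by
  rw [incidentPairs, Finset.prod_image]
  intro x _ y _ h
  rcases Sym2.eq_iff.1 h with h | h
  · exact h.2
  · exact h.2.trans h.1

/-- A lower bound for the probability that a vertex is isolated. -/
theorem le_prod_incidentPairs {m : ℕ} (σ : BalancedLabeling 2 m) (p q : unitInterval)
    (v : Fin (2 * m)) :
    (1 - (p : ℝ)) ^ m * (1 - (q : ℝ)) ^ m ≤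
      ∏ e ∈ incidentPairs v, (1 - ((if (e.map σ.1).IsDiag then p else q : unitInterval) : ℝ)) := by
  have hcard : ∀ k, #{w | σ.1 w = k} = m := fun k => by
    rw [← Fintype.card_subtype]; exact σ.2 k
  have hall : ∏ w, (1 - ((if ((s(v, w)).map σ.1).IsDiag then p else q : unitInterval) : ℝ)) =
      (1 - (p : ℝ)) ^ m * (1 - (q : ℝ)) ^ m := by
    have e1 : ∏ w, (1 - ((if ((s(v, w)).map σ.1).IsDiag then p else q : unitInterval) : ℝ)) =
        ∏ w, (fun k => (1 - ((if σ.1 v = k then p else q : unitInterval) : ℝ))) (σ.1 w) :=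
      Finset.prod_congr rfl fun w _ => by simp
    rw [e1, ← Finset.prod_fiberwise' Finset.univ σ.1
      fun k => (1 - ((if σ.1 v = k then p else q : unitInterval) : ℝ))]
    simp only [Finset.prod_const, hcard, Fin.prod_univ_two]
    generalize σ.1 v = i
    fin_cases i <;> simp [mul_comm]
  rw [prod_incidentPairs, ← hall, ← Finset.mul_prod_erase Finset.univ _ (Finset.mem_univ v)]
  refine mul_le_of_le_one_left (Finset.prod_nonneg fun w _ => ?_) ?_
  · exact sub_nonneg.2 (if _ then p else q : unitInterval).2.2
  · exact sub_le_self 1 (if _ then p else q : unitInterval).2.1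

/-- With probability close to `1` there are many isolated vertices with label `0`. -/
theorem prob_isolatedZero_lt_le {m : ℕ} (σ : BalancedLabeling 2 m) (p q : unitInterval)
    (hp : (p : ℝ) < 1) {M : ℕ} (hM : 0 < M)
    (h : 2 * (M : ℝ) ≤ m * ((1 - (p : ℝ)) ^ m * (1 - (q : ℝ)) ^ m)) :
    prob (sbm σ.1 p q) {K | #(isolatedZero σ.1 K) < M} ≤ ENNReal.ofReal
      (4 * ((m * ((1 - (p : ℝ)) ^ m * (1 - (q : ℝ)) ^ m))⁻¹ + p / (1 - p))) := by
  classical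
  set f : Sym2 (Fin (2 * m)) → unitInterval := fun e => if (e.map σ.1).IsDiag then p else q with hf
  set I : Finset (Fin (2 * m)) := {v | σ.1 v = 0} with hI
  set α : Fin (2 * m) → ℝ := fun v => ∏ e ∈ incidentPairs v, (1 - (f e : ℝ)) with hα
  set g : Fin (2 * m) → Finset (Sym2 (Fin (2 * m))) → ℝ :=
    fun v T => if Disjoint T (incidentPairs v) then 1 else 0 with hg
  have hp1 : 0 < 1 - (p : ℝ) := sub_pos.2 hp
  have hcard : #I = m := by rw [hI, ← Fintype.card_subtype]; exact σ.2 0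
  have hM0 : (0 : ℝ) < M := by exact_mod_cast hM
  have hsum : m * ((1 - (p : ℝ)) ^ m * (1 - (q : ℝ)) ^ m) ≤ ∑ v ∈ I, α v := by
    calc _ = ∑ _v ∈ I, (1 - (p : ℝ)) ^ m * (1 - (q : ℝ)) ^ m := by
          rw [Finset.sum_const, hcard, nsmul_eq_mul]
      _ ≤ ∑ v ∈ I, α v := Finset.sum_le_sum fun v _ => le_prod_incidentPairs σ p q v
  have hcheb := prob_sum_le_half_le (randomSubset f) I g
    (fun v T => by simp only [hg]; split_ifs <;> simp) α
    (div_nonneg p.2.1 hp1.le : 0 ≤ (p : ℝ) / (1 - p))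
    (fun v _ => sum_toReal_randomSubset_disjoint f (incidentPairs v)) ?_ (by linarith)
  · rw [sbm_eq_map, prob_map]
    refine (prob_mono _ ?_).trans (hcheb.trans (ENNReal.ofReal_le_ofReal ?_))
    · intro T hT
      have hT' : #(isolatedZero σ.1 (SimpleGraph.fromEdgeSet (T : Set (Sym2 (Fin (2 * m)))))) < M :=
        hT
      have hX : ∑ v ∈ I, g v T =
          #(isolatedZero σ.1 (SimpleGraph.fromEdgeSet (T : Set (Sym2 (Fin (2 * m)))))) := by
        simp only [hg, hI, isolatedZero, isolated_fromEdgeSet_iff]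
        rw [Finset.sum_boole, Finset.filter_filter]
      change ∑ v ∈ I, g v T ≤ (∑ v ∈ I, α v) / 2
      rw [hX]
      have : (#(isolatedZero σ.1
          (SimpleGraph.fromEdgeSet (T : Set (Sym2 (Fin (2 * m)))))) : ℝ) < M := by
        exact_mod_cast hT'
      linarith
    · have := inv_anti₀ (by linarith) hsum
      linarith
  · intro u hu v hv huv
    have hgg : ∀ T, g u T * g v T =
        if Disjoint T (incidentPairs u ∪ incidentPairs v) then 1 else 0 := fun T => by
      simp only [hg, Finset.disjoint_union_right]
      split_ifs <;> simp_all
    simp only [hgg]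
    rw [sum_toReal_randomSubset_disjoint]
    have huv' : σ.1 u = σ.1 v := by
      simp only [hI, Finset.mem_filter, Finset.mem_univ, true_and] at hu hv
      rw [hu, hv]
    -- the sets of incident pairs share exactly the pair `{u, v}`, so that only its factor is
    -- counted twice
    have hprod := Finset.prod_union_inter (s₁ := incidentPairs u) (s₂ := incidentPairs v)
      (f := fun e => 1 - (f e : ℝ))
    have hfuv : f s(u, v) = p := by simp [hf, huv']
    rw [incidentPairs_inter_incidentPairs huv, Finset.prod_singleton, hfuv] at hprod
    have e1 : 1 + (p : ℝ) / (1 - p) = (1 - (p : ℝ))⁻¹ := by field_simp; ring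
    rw [e1, ← div_eq_mul_inv, le_div_iff₀ hp1]
    exact hprod.le

end Isolated

/-! ### Impossibility of deanonymization -/

theorem exp_neg_le_one_sub {η x : ℝ} (hη : η < 1) (hx0 : 0 ≤ x) (hx : x ≤ η) :
    Real.exp (-(x / (1 - η))) ≤ 1 - x := by
  have h1 : 0 < 1 - x := by linarith
  rw [← Real.le_log_iff_exp_le h1]
  refine le_trans ?_ (Real.one_sub_inv_le_log_of_pos h1)
  have h2 : 1 - (1 - x)⁻¹ = -(x / (1 - x)) := by field_simp; ring
  rw [h2, neg_le_neg_iff]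
  gcongr

/-- Below the connectivity threshold the expected number of isolated vertices diverges. -/
theorem tendsto_expected_isolated {x y : ℕ → ℝ} {a b : ℝ} (ha : 0 ≤ a) (hb : 0 ≤ b)
    (hab : a + b < 2) (hx : ∀ᶠ m : ℕ in atTop, x m = a * Real.log (2 * m : ℕ) / (2 * m : ℕ))
    (hy : ∀ᶠ m : ℕ in atTop, y m = b * Real.log (2 * m : ℕ) / (2 * m : ℕ)) :
    Tendsto (fun m : ℕ => m * ((1 - x m) ^ m * (1 - y m) ^ m)) atTop atTop := by
  set κ := (a + b) / 2 with hκ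
  have hκ0 : 0 ≤ κ := by positivity
  have hκ1 : κ < 1 := by linarith
  -- the slack `η` is chosen such that the exponent `κ / (1 - η)` stays below `1`
  set η := (1 - κ) / 2 with hη
  have hη0 : 0 < η := by linarith
  have hη1 : η < 1 := by linarith
  have hexp : 0 < 1 - κ / (1 - η) := by
    rw [sub_pos, div_lt_one (by linarith)]; linarith
  have hlow : Tendsto (fun m : ℕ => Real.exp ((1 - κ / (1 - η)) * Real.log (2 * m : ℕ)) / 2)
      atTop atTop := by
    refine Tendsto.atTop_div_const two_pos (Real.tendsto_exp_atTop.comp ?_)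
    exact ((Real.tendsto_log_atTop.comp tendsto_natCast_atTop_atTop).comp
      tendsto_two_mul_atTop).const_mul_atTop hexp
  have hsmall : ∀ c : ℝ, ∀ᶠ m : ℕ in atTop, c * Real.log (2 * m : ℕ) / (2 * m : ℕ) < η := fun c =>
    ((tendsto_mul_log_div c).comp tendsto_two_mul_atTop).eventually_lt_const hη0
  refine tendsto_atTop_mono' _ ?_ hlow
  filter_upwards [hx, hy, hsmall a, hsmall b, eventually_ge_atTop 1] with m hxm hym hxs hys hm
  have hm0 : (0 : ℝ) < m := by exact_mod_cast hm
  have hn0 : (0 : ℝ) < ((2 * m : ℕ) : ℝ) := by push_cast; positivity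
  have hL := Real.log_natCast_nonneg (2 * m)
  set L := Real.log (2 * m : ℕ) with hLdef
  have hx0 : 0 ≤ x m := by rw [hxm]; positivity
  have hy0 : 0 ≤ y m := by rw [hym]; positivity
  rw [← hxm] at hxs
  rw [← hym] at hys
  have h1 : Real.exp (-(x m / (1 - η))) ^ m * Real.exp (-(y m / (1 - η))) ^ m ≤
      (1 - x m) ^ m * (1 - y m) ^ m := by
    gcongr
    · exact pow_nonneg (by linarith) m
    · exact exp_neg_le_one_sub hη1 hx0 hxs.le
    · exact exp_neg_le_one_sub hη1 hy0 hys.le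
  refine le_trans (le_of_eq ?_) (mul_le_mul_of_nonneg_left h1 hm0.le)
  rw [← Real.exp_nat_mul, ← Real.exp_nat_mul, ← Real.exp_add]
  have h2 : (m : ℝ) * -(x m / (1 - η)) + m * -(y m / (1 - η)) = -(κ / (1 - η)) * L := by
    rw [hxm, hym, hκ]
    push_cast
    have : 1 - η ≠ 0 := by linarith
    field_simp
    ring
  have h3 : Real.exp L = 2 * m := by rw [hLdef, Real.exp_log hn0]; push_cast; ring
  have h4 : (1 - κ / (1 - η)) * L = L + -(κ / (1 - η)) * L := by ring
  rw [h2, h4, Real.exp_add, h3]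
  ring

/-- If the common subgraph of the two graphs has isolated vertices, then exact deanonymization is
impossible. -/
theorem deanonymizationImpossible_model {a b : ℝ} (ha : 0 ≤ a) (hb : 0 ≤ b)
    (s₁ s₂ t : unitInterval) (h : (s₁ : ℝ) * (s₂ * t) * (a + b) < 2) :
    DeanonymizationImpossible 2 (model 2 a b s₁ s₂ t) := by
  intro A
  set r : unitInterval := s₁ * (s₂ * t) with hr
  have hr' : (r : ℝ) = s₁ * (s₂ * t) := rfl
  rw [← hr'] at h
  set p : ℕ → unitInterval := fun m => edgeProb a (2 * m) * r with hp
  set q : ℕ → unitInterval := fun m => edgeProb b (2 * m) * r with hq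
  have hpe : ∀ᶠ m : ℕ in atTop, (p m : ℝ) = r * a * Real.log (2 * m : ℕ) / (2 * m : ℕ) := by
    filter_upwards [tendsto_two_mul_atTop.eventually (eventually_coe_edgeProb ha)] with m hm
    rw [hp, Set.Icc.coe_mul, hm]; ring
  have hqe : ∀ᶠ m : ℕ in atTop, (q m : ℝ) = r * b * Real.log (2 * m : ℕ) / (2 * m : ℕ) := by
    filter_upwards [tendsto_two_mul_atTop.eventually (eventually_coe_edgeProb hb)] with m hm
    rw [hq, Set.Icc.coe_mul, hm]; ring
  have hE := tendsto_expected_isolated (mul_nonneg r.2.1 ha) (mul_nonneg r.2.1 hb)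
    (by linarith) hpe hqe
  have hp0 : Tendsto (fun m => (p m : ℝ)) atTop (𝓝 0) := by
    refine Tendsto.congr' (hpe.mono fun m hm => hm.symm) ?_
    exact (tendsto_mul_log_div (r * a)).comp tendsto_two_mul_atTop
  have hbound : Tendsto (fun m : ℕ => ENNReal.ofReal
      (4 * ((m * ((1 - (p m : ℝ)) ^ m * (1 - (q m : ℝ)) ^ m))⁻¹ + p m / (1 - p m)))) atTop
      (𝓝 0) := by
    have h1 := hE.inv_tendsto_atTop
    have h2 := hp0.div (tendsto_const_nhds.sub hp0) (by norm_num : (1 : ℝ) - 0 ≠ 0)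
    have h3 := (ENNReal.continuous_ofReal.tendsto _).comp ((h1.add h2).const_mul 4)
    simp only [sub_zero, zero_div, add_zero, mul_zero, ENNReal.ofReal_zero] at h3
    exact h3
  rw [ENNReal.tendsto_nhds_zero]
  intro ε hε
  obtain ⟨M, hM⟩ := ENNReal.exists_inv_nat_lt (ENNReal.half_pos hε.ne').ne'
  -- `M + 1` instead of `M` rules out `M = 0`
  have hM' : ((M + 1 : ℕ) : ENNReal)⁻¹ ≤ ε / 2 :=
    (ENNReal.inv_le_inv.2 (by exact_mod_cast M.le_succ)).trans hM.le
  filter_upwards [ENNReal.tendsto_nhds_zero.1 hbound (ε / 2) (ENNReal.half_pos hε.ne'),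
    hE.eventually_ge_atTop (2 * ((M + 1 : ℕ) : ℝ)), hp0.eventually_lt_const one_pos] with m h1 h2 h3
  refine (prob_attack_le a b s₁ s₂ t m (A m) (M + 1) M.succ_ne_zero (ε / 2) fun σ => ?_).trans ?_
  · exact (prob_isolatedZero_lt_le σ (p m) (q m) h3 M.succ_pos h2).trans h1
  · calc ε / 2 + ((M + 1 : ℕ) : ENNReal)⁻¹ ≤ ε / 2 + ε / 2 := by gcongr
      _ = ε := ENNReal.add_halves ε

/-- In terms of the square roots, the hypothesis of the main result says that the deanonymization
threshold exceeds the recovery threshold. -/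
theorem mul_add_lt_sq_sqrt_sub_sqrt {a b s : ℝ} (hb : 0 ≤ b) (hab : b < a) (hs : s ≤ 1)
    (h : ((a - b) / (a + b)) ^ 2 + (1 - s) ^ 2 > 1) : s * (a + b) < (√a - √b) ^ 2 := by
  have ha : 0 < a := hb.trans_lt hab
  have hc : 0 < a + b := by linarith
  have hsa := Real.sq_sqrt ha.le
  have hsb := Real.sq_sqrt hb
  have h1 : (2 * (√a * √b)) ^ 2 < ((1 - s) * (a + b)) ^ 2 := by
    have e1 : (2 * (√a * √b)) ^ 2 = 4 * (a * b) := by rw [mul_pow, mul_pow, hsa, hsb]; ring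
    have e2 : ((a - b) / (a + b)) ^ 2 * (a + b) ^ 2 = (a - b) ^ 2 := by field_simp
    have h2 : 1 * (a + b) ^ 2 < (((a - b) / (a + b)) ^ 2 + (1 - s) ^ 2) * (a + b) ^ 2 := by
      gcongr
    rw [add_mul, e2] at h2
    rw [e1, mul_pow]
    linarith
  have h2 := lt_of_pow_lt_pow_left₀ 2 (mul_nonneg (sub_nonneg.2 hs) hc.le) h1
  have e : (√a - √b) ^ 2 = a + b - 2 * (√a * √b) := by rw [sub_sq, hsa, hsb]; ring
  rw [e]
  linarith

end CommunityPrivacy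

theorem mainTheorem4 (a b : ℝ) (hb : 0 ≤ b) (hab : b < a) (s₁ s₂ : unitInterval)
    (hrec : CommunityPrivacy.ExactRecoveryPossible 2 (CommunityPrivacy.sensLaw 2 a b s₂))
    (h : ((a - b) / (a + b)) ^ 2 + (1 - (s₁ : ℝ)) ^ 2 > 1) :
    ∃ t : unitInterval,
      CommunityPrivacy.ExactRecoveryPossible 2 (CommunityPrivacy.releasedLaw 2 a b s₁ s₂ t) ∧
      CommunityPrivacy.DeanonymizationImpossible 2 (CommunityPrivacy.model 2 a b s₁ s₂ t) := by
  have ha : 0 ≤ a := hb.trans hab.le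
  have hthr := CommunityPrivacy.mul_add_lt_sq_sqrt_sub_sqrt hb hab s₁.2.2 h
  have hlaw : ∀ t : unitInterval, CommunityPrivacy.releasedLaw 2 a b s₁ s₂ t =
      CommunityPrivacy.sensLaw 2 a b (s₂ * t) := fun t =>
    funext fun m => CommunityPrivacy.releasedLaw_eq_sensLaw 2 a b s₁ s₂ t m
  rcases lt_or_ge ((s₁ : ℝ) * s₂ * (a + b)) 2 with hlt | hge
  · -- no subsampling is needed
    refine ⟨1, ?_, ?_⟩
    · rwa [hlaw, mul_one]
    · exact CommunityPrivacy.deanonymizationImpossible_model ha hb s₁ s₂ 1 (by simpa using hlt)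
  · set R := (√a - √b) ^ 2 with hR
    have hc : 0 < a + b := by linarith
    have hs₁ : 0 < (s₁ : ℝ) := by
      refine lt_of_le_of_ne s₁.2.1 fun h0 => ?_
      rw [← h0] at hge; linarith
    have hs₂ : 0 < (s₂ : ℝ) := by
      refine lt_of_le_of_ne s₂.2.1 fun h0 => ?_
      rw [← h0] at hge; linarith
    have hR0 : 0 < R := (mul_pos hs₁ hc).trans hthr
    -- `u = s₂ * t` has to lie strictly between the two thresholds `2 / R` and `2 / (s₁ (a + b))`
    obtain ⟨u, hu1, hu2⟩ := exists_between
      (div_lt_div_of_pos_left two_pos (mul_pos hs₁ hc) hthr)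
    rw [div_lt_iff₀ hR0] at hu1
    rw [lt_div_iff₀ (mul_pos hs₁ hc)] at hu2
    have hu0 : 0 < u := (mul_pos_iff_of_pos_right hR0).1 (two_pos.trans hu1)
    have hus : u ≤ s₂ := by
      by_contra hcon
      push Not at hcon
      have := mul_lt_mul_of_pos_right hcon (mul_pos hs₁ hc)
      linarith
    refine ⟨⟨u / s₂, by positivity, (div_le_one hs₂).2 hus⟩, ?_, ?_⟩
    · rw [hlaw]
      refine CommunityPrivacy.exactRecoveryPossible_sensLaw hb hab _ ?_
      rw [Set.Icc.coe_mul, mul_div_cancel₀ u hs₂.ne']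
      exact hu1
    · refine CommunityPrivacy.deanonymizationImpossible_model ha hb s₁ s₂ _ ?_
      rw [mul_div_cancel₀ u hs₂.ne']
      linarith
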